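/- **Setup.** Let $\mathbb N=\{0,1,2,\dots\}$. For $\alpha\in \mathrm{Mat}_{m,n}(\mathbb N)$ let $\mathrm{RSK}(\alpha)=(P,Q)$ be the pair of semistandard tableaux obtained by reading the entries of $\alpha$ down the columns, the columns being taken from left to right, recording $\alpha_{ij}$ copies of the biletter $(i|j)$, and successively row inserting the biletters $(p|q)$ into $(\emptyset,\emptyset)$: $p$ is row inserted into $P$, and $q$ is placed in $Q$ in the position of the new box. Let $[P|Q]$ be the product over $c$ of the minors of the generic matrix $Z=(z_{ij})$ whose row and column indices are the entries of the $c$-th columns of $P$ and $Q$. Let $\mathsf{RSK}$ be the linear operator on $\mathbb C[z_{ij}]_{1\le i\le m,\,1\le j\le n}$ with $z^\alpha\mapsto[P|Q]$. Let $\mathsf{RSK}_{m,n,d}$ be its matrix, in the monomial basis, on polynomials of degree $d$. A weight pair of degree $d$ is $(\sigma,\pi)\in\mathbb N^a\times\mathbb N^b$ with $|\sigma|=|\pi|=d$; write $\ell(\sigma)=a$, $\ell(\pi)=b$. Let $\mathsf{RSK}_{\sigma,\pi}$ be the matrix (for $m=a$, $n=b$) of $\mathsf{RSK}$ on the span of the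 monomials $z^\alpha$ for which $\alpha$ has row sums $\sigma$ and column sums $\pi$. The pair is *reduced* if $\max_i\sigma_i+\max_j\pi_j\le d$. Order weight pairs by the covering relations $(\sigma,\pi)\prec(\sigma+\vec e_k,\pi+\vec e_l)$ whenever $\sigma_k+\pi_l\ge|\sigma|$. For a reduced pair $(\sigma,\pi)$ let $A_{\sigma,\pi}(d)$ be the number of weight pairs of degree $d$ in $\mathbb N^{\ell(\sigma)}\times\mathbb N^{\ell(\pi)}$ that are $\succeq(\sigma,\pi)$ (those that reduce to $(\sigma,\pi)$). Put $$N_{\sigma,\pi}(m,n,d)=\begin{cases}A_{\sigma,\pi}(d)\left(\binom m{\ell(\sigma)}\binom n{\ell(\pi)}+\binom m{\ell(\pi)}\binom n{\ell(\sigma)}\right)&\text{if }\sigma\ne\pi,\\ A_{\sigma,\pi}(d)\binom m{\ell(\sigma)}\binom n{\ell(\pi)}&\text{if }\sigma=\pi,\end{cases}$$ $$N_0(m,n,d)=\binom{d+n-1}{d}m+\binom{d+m-1}{d}n-mn .$$ **Theorem.** Fix $d\in\mathbb N$. (a) If $d\ge1$, then for all $m,n\in\mathbb N$ $$\operatorname{Tr}\mathsf{RSK}_{m,n,d}=N_0(m,n,d)+\sum_{(\sigma,\pi)}N_{\sigma,\pi}(m,n,d)\operatorname{Tr}\mathsf{RSK}_{\sigma,\pi},$$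 where the sum is over the reduced weight pairs $(\sigma,\pi)$ of degree $1\le d'\le d$ with all entries nonzero, with $\ell(\sigma)\le\ell(\pi)$, and such that if $\ell(\sigma)=\ell(\pi)$, then $\sigma=\pi$ or $\sigma_i>\pi_i$ for the least $i$ with $\sigma_i\ne\pi_i$. (b) $\operatorname{Tr}\mathsf{RSK}_{m,n,d}$ is given by a polynomial in $m,n$ for all $m,n\in\mathbb N$, and it is $O(m^dn^d)$: there is $K$, depending only on $d$, with $|\operatorname{Tr}\mathsf{RSK}_{m,n,d}|\le K\,m^dn^d$ for all $m,n\in\mathbb N$ (where $0^0=1$). (c) If $\operatorname{Tr}\mathsf{RSK}_{1^d,1^d}\ne0$, where $1^d=(1,\dots,1)\in\mathbb N^d$, then this polynomial has total degree $2d$ and its homogeneous part of degree $2d$ is $$\frac{\operatorname{Tr}\mathsf{RSK}_{1^d,1^d}}{(d!)^2}\,m^dn^d .$$ -/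

import Mathlib

namespace RSKTrace

/-! ### The combinatorial RSK correspondence

A tableau is represented by the list of its rows (top to bottom), each row being the list of its
labels (left to right). Labels lie in a linearly ordered alphabet, here `Fin m` or `Fin n`. -/

section Insertion

variable {A : Type*} [LinearOrder A]

/-- Insertion of `p` into a single weakly increasing row: `p` replaces the leftmost label that is
larger than `p`, and that label is returned as the bumped label; if there is none, then `p` is
adjoined to the end of the row and nothing is bumped. -/
def rowInsert : List A → A → List A × Option A
  | [], p => ([p], none)
  | a :: r, p =>
      if p < a then (p :: r, some a)
      else ((a :: (rowInsert r p).1), (rowInsert r p).2)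

/-- Row insertion `P ← p` of a label into a tableau, together with the (0-based) index of the row
which the new box ends. -/
def tableauInsert : List (List A) → A → List (List A) × ℕ
  | [], p => ([[p]], 0)
  | r :: T, p =>
      match rowInsert r p with
      | (r', none) => (r' :: T, 0)
      | (r', some b) => (r' :: (tableauInsert T b).1, (tableauInsert T b).2 + 1)

/-- Adjoin a box with label `q` to the end of row `i` of a tableau. -/
def addBox {B : Type*} : List (List B) → ℕ → B → List (List B)
  | [], _, q => [[q]]
  | r :: T, 0, q => (r ++ [q]) :: T
  | r :: T, i + 1, q => r :: addBox T i q

/-- Insertion `(P, Q) ← (p | q)` of a biletter. -/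
def biletterInsert {B : Type*} (PQ : List (List A) × List (List B)) (b : A × B) :
    List (List A) × List (List B) :=
  ((tableauInsert PQ.1 b.1).1, addBox PQ.2 (tableauInsert PQ.1 b.1).2 b.2)

end Insertion

/-- The biword of an exponent matrix `α`: read the entries down the columns, the columns being
taken from left to right, and record `α (i, j)` copies of the biletter `(i | j)`. -/
def biword {m n : ℕ} (α : Fin m × Fin n →₀ ℕ) : List (Fin m × Fin n) :=
  (List.finRange n).flatMap fun j =>
    (List.finRange m).flatMap fun i => List.replicate (α (i, j)) (i, j)

/-- The RSK correspondence `α ↦ (P, Q)`. -/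
def rsk {m n : ℕ} (α : Fin m × Fin n →₀ ℕ) : List (List (Fin m)) × List (List (Fin n)) :=
  (biword α).foldl biletterInsert ([], [])

/-! ### Bitableaux and the linear operator RSK -/

/-- The labels in column `c` of a tableau, from top to bottom. -/
def tableauColumn {A : Type*} (T : List (List A)) (c : ℕ) : List A :=
  T.filterMap fun r => r[c]?

/-- The minor of the generic `m × n` matrix `Z = (z_ij)` whose row and column indices are the first
and the second components, respectively, of the pairs in the list `L`. -/
noncomputable def minor {m n : ℕ} (L : List (Fin m × Fin n)) :
    MvPolynomial (Fin m × Fin n) ℂ :=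
  Matrix.det (Matrix.of fun a b : Fin L.length => MvPolynomial.X ((L.get a).1, (L.get b).2))

/-- The bitableau `[P | Q]` of two tableaux of the same shape: the product over the columns `c` of
the minors whose row indices form column `c` of `P` and whose column indices form column `c`
of `Q`. -/
noncomputable def bitableau {m n : ℕ} (PQ : List (List (Fin m)) × List (List (Fin n))) :
    MvPolynomial (Fin m × Fin n) ℂ :=
  ∏ c ∈ Finset.range (PQ.1.headD []).length,
    minor ((tableauColumn PQ.1 c).zip (tableauColumn PQ.2 c))

/-- The operator `RSK` on `ℂ[z_ij]`: the linear extension of `z^α ↦ [P | Q]`,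
`(P, Q) = RSK(α)`. -/
noncomputable def RSK (m n : ℕ) :
    MvPolynomial (Fin m × Fin n) ℂ →ₗ[ℂ] MvPolynomial (Fin m × Fin n) ℂ :=
  (MvPolynomial.basisMonomials (Fin m × Fin n) ℂ).constr ℂ fun α => bitableau (rsk α)

/-! ### The matrices of RSK in degree `d` and on a weight space -/

/-- The exponent matrices of the monomials of degree `d`. -/
def exponents (m n d : ℕ) : Finset (Fin m × Fin n →₀ ℕ) :=
  Finset.finsuppAntidiag Finset.univ d

/-- The contingency tables with row margins `σ` and column margins `π`. -/
def contingencyTables {a b : ℕ} (σ : Fin a → ℕ) (π : Fin b → ℕ) :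
    Finset (Fin a × Fin b →₀ ℕ) :=
  (exponents a b (∑ i, σ i)).filter fun α =>
    (∀ i, ∑ j, α (i, j) = σ i) ∧ ∀ j, ∑ i, α (i, j) = π j

/-- `RSK_{m,n,d}`: the matrix, in the monomial basis, of `RSK` on the homogeneous polynomials of
degree `d`; the entry in row `β` and column `α` is the coefficient of `z^β` in `RSK(z^α)`. -/
noncomputable def degreeMatrix (m n d : ℕ) :
    Matrix (exponents m n d) (exponents m n d) ℂ :=
  Matrix.of fun β α => MvPolynomial.coeff β.1 (RSK m n (MvPolynomial.monomial α.1 1))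

/-- `RSK_{σ,π}`: the matrix, in the monomial basis, of `RSK` on the weight space of `(σ, π)`. -/
noncomputable def weightMatrix {a b : ℕ} (σ : Fin a → ℕ) (π : Fin b → ℕ) :
    Matrix (contingencyTables σ π) (contingencyTables σ π) ℂ :=
  Matrix.of fun β α => MvPolynomial.coeff β.1 (RSK a b (MvPolynomial.monomial α.1 1))

/-! ### Reduced pairs and multiplicities

Weights of degree `d` with nonzero entries are compositions of `d`. -/

/-- A weight pair `(σ, π)` is reduced if `max σ + max π ≤ |σ|`. -/
def IsReduced {a b : ℕ} (σ : Fin a → ℕ) (π : Fin b → ℕ) : Prop :=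
  Finset.univ.sup σ + Finset.univ.sup π ≤ ∑ i, σ i

/-- The normalization of weight pairs: `ℓ(σ) ≤ ℓ(π)`, and in case of equality either `σ = π` or
`σ_i > π_i` for the least `i` with `σ_i ≠ π_i`. -/
def IsNormalized {d : ℕ} (σ π : Composition d) : Prop :=
  σ.length ≤ π.length ∧
    (σ.length = π.length → σ = π ∨ List.Lex (fun x y : ℕ => x > y) σ.blocks π.blocks)

open scoped Classical in
/-- The reduced weight pairs of degree `d` that have nonzero entries and are normalized. -/
noncomputable def reducedPairs (d : ℕ) : Finset (Composition d × Composition d) :=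
  Finset.univ.filter fun p => IsReduced p.1.blocksFun p.2.blocksFun ∧ IsNormalized p.1 p.2

/-- The covering relation `(σ, π) ≺ (σ + e_k, π + e_l)`, `σ_k + π_l ≥ |σ|`, of the
variable-multiplication poset. -/
def Covers {a b : ℕ} (p q : (Fin a → ℕ) × (Fin b → ℕ)) : Prop :=
  ∃ k l, ∑ i, p.1 i ≤ p.1 k + p.2 l ∧
    q.1 = p.1 + Pi.single k 1 ∧ q.2 = p.2 + Pi.single l 1

/-- `A_{σ,π}(d)`: the number of weight pairs of degree `d` that reduce to `(σ, π)`, that is, lie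
above it in the variable-multiplication poset. -/
noncomputable def reductionCount {a b : ℕ} (σ : Fin a → ℕ) (π : Fin b → ℕ) (d : ℕ) : ℕ :=
  {q : (Fin a → ℕ) × (Fin b → ℕ) |
    ∑ i, q.1 i = d ∧ ∑ j, q.2 j = d ∧ Relation.ReflTransGen Covers (σ, π) q}.ncard

open scoped Classical in
/-- The multiplicity `N_{σ,π}(m, n, d)`. -/
noncomputable def multiplicity {e : ℕ} (σ π : Composition e) (m n d : ℕ) : ℕ :=
  if σ = π then
    reductionCount σ.blocksFun π.blocksFun d * (m.choose σ.length * n.choose π.length)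
  else
    reductionCount σ.blocksFun π.blocksFun d *
      (m.choose σ.length * n.choose π.length + m.choose π.length * n.choose σ.length)

/-- The multiplicity `N_0(m, n, d)`, used for `d ≥ 1` only. -/
def multiplicityZero (m n d : ℕ) : ℤ :=
  ((d + n - 1).choose d : ℤ) * m + ((d + m - 1).choose d : ℤ) * n - (m : ℤ) * n

end RSKTrace

namespace RSKTrace

/-! ### Relabeling -/

section Relabel

variable {A A' B B' : Type*} [LinearOrder A] [LinearOrder A'] {f : A → A'}

/-! The trace is the sum, over the exponent matrices α of degree d, of the coefficient of z^α in its
own bitableau [P|Q]. Grouping by margins gives the traces on the weight spaces, and three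
invariances relate these to each other. Zero rows and columns can be deleted, since insertion only
compares labels (`diagCoeff_mapDomain`). Transposition of α exchanges P and Q (`arrayRSK_swap`), so
σ and π can be exchanged. If σ_k + π_l ≥ |σ|, then incrementing α_kl multiplies [P|Q] by z_kl
(`pairBitableau_increment`) and is a bijection of contingency tables, so the trace is constant along
covering relations (`weightTrace_eq_of_covers`).

The last two facts rest on last passage times, L(i+1,j+1) = max(L(i,j+1), L(i+1,j)) + a_ij. After j
columns of the array a have been inserted, the first row of P contains L(i,j) labels smaller than i;
the labels bumped from it form the array min(L(i,j+1), L(i+1,j)) − L(i,j), which determines the next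
row in the same way (`rows_insertWord`). The rule is symmetric in i and j, hence the transposition
symmetry. If row k and column l of the array contain at least the whole weight, incrementing a_kl
raises L by one beyond (k,l) and does not change the bumped array. So only the first rows of P and Q
change, and the new k and l can be placed in the same column, to the right of all lower rows.

Lowering steps commute, so a pair lies above at most one reduced pair (`reduced_unique`). A pair in
which one weight has a single nonzero entry reduces to zero and has trace 1; inclusion and exclusion
over these gives N_0. Reduction of any other pair keeps nonzero entries nonzero, so the remaining
pairs can be counted by support and by reduced pair.

For polynomiality, the trace is a combination of the products of m choose a and n choose b with a, b
≤ d and coefficients independent of m and n. Only a = b = d reaches degree 2d, and 1^d is the only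
weight of length and degree d with nonzero entries. -/

theorem rowInsert_map (hf : StrictMono f) (r : List A) (p : A) :
    rowInsert (r.map f) (f p) = ((rowInsert r p).1.map f, (rowInsert r p).2.map f) := by
  induction r with
  | nil => simp [rowInsert]
  | cons a r ih =>
    simp only [List.map_cons, rowInsert, hf.lt_iff_lt]
    split_ifs <;> simp [ih]

theorem tableauInsert_map (hf : StrictMono f) (T : List (List A)) (p : A) :
    tableauInsert (T.map (List.map f)) (f p) =
      ((tableauInsert T p).1.map (List.map f), (tableauInsert T p).2) := by
  induction T generalizing p with
  | nil => simp [tableauInsert]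
  | cons r T ih =>
    simp only [List.map_cons, tableauInsert, rowInsert_map hf]
    rcases rowInsert r p with ⟨r', _ | b⟩ <;> simp [ih]

theorem addBox_map (g : B → B') (T : List (List B)) (i : ℕ) (q : B) :
    addBox (T.map (List.map g)) i (g q) = (addBox T i q).map (List.map g) := by
  induction T generalizing i with
  | nil => simp [addBox]
  | cons r T ih => cases i <;> simp [addBox, ih]

/-- Relabeling of a pair of tableaux. -/
def mapPair (f : A → A') (g : B → B') (PQ : List (List A) × List (List B)) :
    List (List A') × List (List B') :=
  (PQ.1.map (List.map f), PQ.2.map (List.map g))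

theorem biletterInsert_map (hf : StrictMono f) (g : B → B')
    (PQ : List (List A) × List (List B)) (b : A × B) :
    biletterInsert (mapPair f g PQ) (Prod.map f g b) = mapPair f g (biletterInsert PQ b) := by
  simp [biletterInsert, mapPair, tableauInsert_map hf, addBox_map]

theorem foldl_biletterInsert_map (hf : StrictMono f) (g : B → B') (w : List (A × B))
    (PQ : List (List A) × List (List B)) :
    (w.map (Prod.map f g)).foldl biletterInsert (mapPair f g PQ) =
      mapPair f g (w.foldl biletterInsert PQ) := by
  induction w generalizing PQ with
  | nil => rfl
  | cons b w ih => simp only [List.map_cons, List.foldl_cons, biletterInsert_map hf, ih]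

end Relabel

/-! ### Rows of a tableau -/

section Rows

variable {A B : Type*}

/-- Row `r` of a tableau, empty if there is no such row. -/
def row (T : List (List A)) (r : ℕ) : List A := T.getD r []

@[simp] theorem row_nil (r : ℕ) : row ([] : List (List A)) r = [] := by simp [row]

@[simp] theorem row_cons_zero (x : List A) (T : List (List A)) : row (x :: T) 0 = x := rfl

@[simp] theorem row_cons_succ (x : List A) (T : List (List A)) (r : ℕ) :
    row (x :: T) (r + 1) = row T r := rfl

theorem row_tail (T : List (List A)) (r : ℕ) : row T.tail r = row T (r + 1) := by
  cases T <;> simp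

theorem headD_eq_row (T : List (List A)) : T.headD [] = row T 0 := by
  cases T <;> simp

/-- `row` does not distinguish an empty row from a missing one, hence the hypotheses that all rows
are nonempty. -/
theorem eq_of_rows_eq {T T' : List (List A)} (hT : ∀ x ∈ T, x ≠ []) (hT' : ∀ x ∈ T', x ≠ [])
    (h : ∀ r, row T r = row T' r) : T = T' := by
  induction T generalizing T' with
  | nil =>
    cases T' with
    | nil => rfl
    | cons y T' => exact absurd (by simpa using (h 0).symm) (hT' y (by simp))
  | cons x T ih =>
    cases T' with
    | nil => exact absurd (by simpa using h 0) (hT x (by simp))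
    | cons y T' =>
      rw [show x = y by simpa using h 0]
      rw [ih (fun z hz => hT z (.tail _ hz)) (fun z hz => hT' z (.tail _ hz))
        (fun r => by simpa using h (r + 1))]

variable [LinearOrder A]

theorem rowInsert_ne_nil (r : List A) (p : A) : (rowInsert r p).1 ≠ [] := by
  cases r with
  | nil => simp [rowInsert]
  | cons a r => rw [rowInsert]; split_ifs <;> simp

theorem tableauInsert_ne_nil {T : List (List A)} (hT : ∀ x ∈ T, x ≠ []) (p : A) :
    ∀ x ∈ (tableauInsert T p).1, x ≠ [] := by
  induction T generalizing p with
  | nil => simp [tableauInsert]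
  | cons r T ih =>
    have h := rowInsert_ne_nil r p
    have hT' : ∀ x ∈ T, x ≠ [] := fun x hx => hT x (by simp [hx])
    rw [tableauInsert]
    generalize rowInsert r p = y at h ⊢
    obtain ⟨r', _ | b⟩ := y
    · simpa using ⟨h, hT'⟩
    · simpa using ⟨h, ih hT' b⟩

theorem addBox_ne_nil {T : List (List B)} (hT : ∀ x ∈ T, x ≠ []) (i : ℕ) (q : B) :
    ∀ x ∈ addBox T i q, x ≠ [] := by
  induction T generalizing i with
  | nil => simp [addBox]
  | cons r T ih =>
    have hT' : ∀ x ∈ T, x ≠ [] := fun x hx => hT x (by simp [hx])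
    cases i with
    | zero => simpa [addBox] using hT'
    | succ i => simpa [addBox] using ⟨hT r (by simp), ih hT' i⟩

theorem rowInsert_perm (r : List A) (p : A) :
    ((rowInsert r p).2.toList ++ (rowInsert r p).1).Perm (p :: r) := by
  induction r with
  | nil => simp [rowInsert]
  | cons a r ih =>
    rw [rowInsert]
    split_ifs
    · simpa using List.Perm.swap _ _ _
    · exact (List.perm_middle.trans (ih.cons a)).trans (List.Perm.swap _ _ _)

theorem tableauInsert_perm (T : List (List A)) (p : A) :
    (tableauInsert T p).1.flatten.Perm (p :: T.flatten) := by
  induction T generalizing p with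
  | nil => simp [tableauInsert]
  | cons r T ih =>
    have h := rowInsert_perm r p
    rw [tableauInsert]
    generalize rowInsert r p = y at h ⊢
    obtain ⟨r', _ | b⟩ := y
    · simpa using h.append_right T.flatten
    · simp only [List.flatten_cons, Option.toList_some, List.singleton_append] at h ⊢
      refine ((ih b).append_left r').trans (List.perm_middle.trans ?_)
      simpa using h.append_right T.flatten

theorem tableauInsert_snd_le (T : List (List A)) (p : A) :
    (tableauInsert T p).2 ≤ T.length := by
  induction T generalizing p with
  | nil => simp [tableauInsert]
  | cons r T ih =>
    rw [tableauInsert]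
    rcases rowInsert r p with ⟨r', _ | b⟩
    · simp
    · simpa using ih b

theorem length_row_tableauInsert (T : List (List A)) (p : A) (r : ℕ) :
    (row (tableauInsert T p).1 r).length =
      (row T r).length + if r = (tableauInsert T p).2 then 1 else 0 := by
  induction T generalizing p r with
  | nil => cases r <;> simp [tableauInsert]
  | cons x T ih =>
    have h := (rowInsert_perm x p).length_eq
    rw [tableauInsert]
    generalize rowInsert x p = y at h ⊢
    obtain ⟨r', _ | b⟩ := y
    · cases r with
      | zero => simpa using h
      | succ r => simp
    · cases r with
      | zero =>
        simp only [Option.toList_some, List.singleton_append, List.length_cons] at h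
        simp only [row_cons_zero, right_eq_add]
        simp
        omega
      | succ r => simp [ih]

theorem row_addBox {T : List (List B)} {i : ℕ} (hi : i ≤ T.length) (q : B) (r : ℕ) :
    row (addBox T i q) r = row T r ++ if r = i then [q] else [] := by
  induction T generalizing i r with
  | nil =>
    obtain rfl : i = 0 := by simpa using hi
    cases r <;> simp [addBox]
  | cons x T ih =>
    cases i with
    | zero => cases r <;> simp [addBox]
    | succ i =>
      cases r with
      | zero => simp [addBox]
      | succ r => simp [addBox, ih (by simpa using hi)]

theorem length_addBox {T : List (List B)} {i : ℕ} (hi : i ≤ T.length) (q : B) :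
    (addBox T i q).length = T.length + if i = T.length then 1 else 0 := by
  induction T generalizing i with
  | nil => 
    obtain rfl : i = 0 := by simpa using hi
    simp [addBox]
  | cons x T ih =>
    cases i with
    | zero => simp [addBox]
    | succ i => simp [addBox, ih (by simpa using hi)]; omega

theorem length_tableauInsert (T : List (List A)) (p : A) :
    (tableauInsert T p).1.length =
      T.length + if (tableauInsert T p).2 = T.length then 1 else 0 := by
  induction T generalizing p with
  | nil => simp [tableauInsert]
  | cons x T ih =>
    rw [tableauInsert]
    rcases rowInsert x p with ⟨r', _ | b⟩
    · simp
    · simp [ih]; omega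

end Rows

/-! ### Insertion of a weakly increasing word -/

/-- The number of labels smaller than `i` in a list. -/
def cnt (r : List ℕ) (i : ℕ) : ℕ := r.countP (· < i)

@[simp] theorem cnt_nil (i : ℕ) : cnt [] i = 0 := rfl

@[simp] theorem cnt_cons (a : ℕ) (r : List ℕ) (i : ℕ) :
    cnt (a :: r) i = cnt r i + if a < i then 1 else 0 := by
  simp [cnt, List.countP_cons]

@[simp] theorem cnt_append (r s : List ℕ) (i : ℕ) : cnt (r ++ s) i = cnt r i + cnt s i := by
  simp [cnt]

theorem cnt_zero (r : List ℕ) : cnt r 0 = 0 := by simp [cnt]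

theorem cnt_succ (r : List ℕ) (i : ℕ) : cnt r (i + 1) = cnt r i + r.count i := by
  induction r with
  | nil => simp
  | cons a r ih =>
    simp only [cnt_cons, List.count_cons, ih, beq_iff_eq]
    split_ifs <;> omega

theorem cnt_mono (r : List ℕ) : Monotone (cnt r) :=
  monotone_nat_of_le_succ fun i => by rw [cnt_succ]; omega

theorem cnt_perm {r s : List ℕ} (h : r.Perm s) (i : ℕ) : cnt r i = cnt s i := h.countP_eq _

theorem cnt_eq_zero {r : List ℕ} {i : ℕ} (h : ∀ x ∈ r, i ≤ x) : cnt r i = 0 := by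
  simpa [cnt, List.countP_eq_zero] using h

theorem cnt_eq_length {r : List ℕ} {i : ℕ} (h : ∀ x ∈ r, x < i) : cnt r i = r.length := by
  simpa [cnt, List.countP_eq_length] using h

/-- Differences of consecutive counts are multiplicities, and a sorted list is determined by its
multiplicities. All tableaux below are compared in this way. -/
theorem eq_of_cnt_eq {r s : List ℕ} (hr : r.Pairwise (· ≤ ·)) (hs : s.Pairwise (· ≤ ·))
    (h : ∀ i, cnt r i = cnt s i) : r = s := by
  refine List.Perm.eq_of_pairwise (fun a b _ _ => le_antisymm) hr hs (List.perm_iff_count.2 fun i => ?_)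
  have h1 := h i
  have h2 := h (i + 1)
  rw [cnt_succ, cnt_succ] at h2
  omega

theorem rowInsert_sorted {r : List ℕ} (hr : r.Pairwise (· ≤ ·)) (p : ℕ) :
    (rowInsert r p).1.Pairwise (· ≤ ·) := by
  induction r with
  | nil => simp [rowInsert]
  | cons a r ih =>
    rw [List.pairwise_cons] at hr
    rw [rowInsert]
    split_ifs with h
    · exact List.pairwise_cons.2 ⟨fun x hx => h.le.trans (hr.1 x hx), hr.2⟩
    · refine List.pairwise_cons.2 ⟨fun x hx => ?_, ih hr.2⟩
      have := (rowInsert_perm r p).subset (List.mem_append_right _ hx)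
      rcases List.mem_cons.1 this with rfl | hx
      · omega
      · exact hr.1 x hx

/-- The label p lands right after the labels at most p. For i > p the count grows by one unless a
label smaller than i is bumped, which happens exactly when r has labels strictly between p and i;
the maximum covers both cases. -/
theorem cnt_rowInsert {r : List ℕ} (hr : r.Pairwise (· ≤ ·)) (p i : ℕ) :
    cnt (rowInsert r p).1 i =
      if p < i then max (cnt r i) (cnt r (p + 1) + 1) else cnt r i := by
  induction r with
  | nil => simp [rowInsert]
  | cons a r ih =>
    rw [List.pairwise_cons] at hr
    rw [rowInsert]
    split_ifs with h h' h'
    · have : cnt r (p + 1) = 0 := cnt_eq_zero fun x hx => Nat.succ_le_of_lt (h.trans_le (hr.1 x hx))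
      simp only [cnt_cons, this]
      by_cases hai : a < i
      · simp [h', hai, h.not_ge]
      · have : cnt r i = 0 := cnt_eq_zero fun x hx => (not_lt.1 hai).trans (hr.1 x hx)
        simp [h', hai, this]; omega
    · simp only [cnt_cons]
      rw [if_neg h', if_neg (by omega)]
    · simp only [cnt_cons, ih hr.2, if_pos h']
      rw [if_pos (by omega), if_pos (by omega)]
      omega
    · simp only [cnt_cons, ih hr.2, if_neg h']

theorem cnt_rowInsert_add (r : List ℕ) (p i : ℕ) :
    cnt (rowInsert r p).2.toList i + cnt (rowInsert r p).1 i = cnt (p :: r) i := by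
  rw [← cnt_append, cnt_perm (rowInsert_perm r p)]

theorem rowInsert_bumped_mem {r : List ℕ} {p b : ℕ} (h : (rowInsert r p).2 = some b) :
    b ∈ r := by
  induction r with
  | nil => simp [rowInsert] at h
  | cons a r ih =>
    rw [rowInsert] at h
    split_ifs at h
    · simp_all
    · exact .tail _ (ih h)

/-- A label bumped by a later, weakly larger label is weakly larger. -/
theorem rowInsert_bumped {r : List ℕ} (hr : r.Pairwise (· ≤ ·)) {p q b c : ℕ} (hpq : p ≤ q)
    (hb : (rowInsert r p).2 = some b) (hc : (rowInsert (rowInsert r p).1 q).2 = some c) :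
    b ≤ c := by
  induction r with
  | nil => simp [rowInsert] at hb
  | cons a r ih =>
    rw [List.pairwise_cons] at hr
    rw [rowInsert] at hb hc
    split_ifs at hb hc with h
    · simp only [Option.some.injEq] at hb
      subst hb
      rw [rowInsert, if_neg (by omega)] at hc
      exact hr.1 _ (rowInsert_bumped_mem hc)
    · simp only at hc
      rw [rowInsert, if_neg (by omega)] at hc
      exact ih hr.2 hb hc

/-- A label that bumps nothing is followed by no bumping by weakly larger labels. -/
theorem rowInsert_not_bumped {r : List ℕ} {p q : ℕ} (hpq : p ≤ q)
    (hb : (rowInsert r p).2 = none) : (rowInsert (rowInsert r p).1 q).2 = none := by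
  induction r with
  | nil => simp [rowInsert, hpq.not_gt]
  | cons a r ih =>
    rw [rowInsert] at hb ⊢
    split_ifs at hb ⊢ with h
    simp only at hb ⊢
    rw [rowInsert, if_neg (by omega)]
    exact ih hb

/-- Insertion of a word into a row: the new row, and the word of the bumped labels. -/
def rowInsertWord : List ℕ → List ℕ → List ℕ × List ℕ
  | r, [] => (r, [])
  | r, p :: w =>
    ((rowInsertWord (rowInsert r p).1 w).1,
      (rowInsert r p).2.toList ++ (rowInsertWord (rowInsert r p).1 w).2)

theorem rowInsertWord_sorted {r : List ℕ} (hr : r.Pairwise (· ≤ ·)) (w : List ℕ) :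
    (rowInsertWord r w).1.Pairwise (· ≤ ·) := by
  induction w generalizing r with
  | nil => exact hr
  | cons p w ih => exact ih (rowInsert_sorted hr p)

theorem cnt_rowInsertWord_add (r w : List ℕ) (i : ℕ) :
    cnt (rowInsertWord r w).2 i + cnt (rowInsertWord r w).1 i = cnt w i + cnt r i := by
  induction w generalizing r with
  | nil => simp [rowInsertWord]
  | cons p w ih =>
    have h1 := ih (rowInsert r p).1
    have h2 := cnt_rowInsert_add r p i
    simp only [rowInsertWord, cnt_append, cnt_cons] at h1 h2 ⊢
    omega

theorem rowInsertWord_bumped_sorted {r w : List ℕ} (hr : r.Pairwise (· ≤ ·))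
    (hw : w.Pairwise (· ≤ ·)) : (rowInsertWord r w).2.Pairwise (· ≤ ·) := by
  -- bumped labels bound later ones from below, whatever the intermediate label
  have key : ∀ (w r : List ℕ) (p b : ℕ), r.Pairwise (· ≤ ·) → (p :: w).Pairwise (· ≤ ·) →
      (rowInsert r p).2 = some b → ∀ c ∈ (rowInsertWord (rowInsert r p).1 w).2, b ≤ c := by
    intro w
    induction w with
    | nil => simp [rowInsertWord]
    | cons q w ih =>
      intro r p b hr hw hb c hc
      rw [List.pairwise_cons] at hw
      have hpq : p ≤ q := hw.1 q (by simp)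
      rw [rowInsertWord, List.mem_append] at hc
      cases h : (rowInsert (rowInsert r p).1 q).2 with
      | none =>
        exfalso
        -- Once an insertion bumps nothing, the later, weakly larger labels bump nothing either, so
        -- there is no such c.
        have hnone : ∀ (w s : List ℕ) (q : ℕ), (q :: w).Pairwise (· ≤ ·) →
            (rowInsert s q).2 = none → (rowInsertWord (rowInsert s q).1 w).2 = [] := by
          intro w
          induction w with
          | nil => simp [rowInsertWord]
          | cons x w ih =>
            intro s q hq hs
            rw [List.pairwise_cons] at hq
            have := rowInsert_not_bumped (hq.1 x (by simp)) hs
            simp [rowInsertWord, this, ih _ _ hq.2 this]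
        simp [h, hnone w _ q hw.2 h] at hc
      | some b' =>
        have hbb' := rowInsert_bumped hr hpq hb h
        rcases hc with hc | hc
        · simp only [h, Option.toList_some, List.mem_singleton] at hc
          omega
        · exact hbb'.trans (ih _ q b' (rowInsert_sorted hr p) hw.2 h c hc)
  induction w generalizing r with
  | nil => simp [rowInsertWord]
  | cons p w ih =>
    rw [rowInsertWord, List.pairwise_append]
    refine ⟨by cases (rowInsert r p).2 <;> simp,
      ih (rowInsert_sorted hr p) (List.pairwise_cons.1 hw).2, fun b hb c hc => ?_⟩
    exact key w r p b hr hw (by simpa using hb) c hc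

theorem cnt_le_cnt_rowInsertWord {r : List ℕ} (hr : r.Pairwise (· ≤ ·)) (w : List ℕ) (i : ℕ) :
    cnt r i ≤ cnt (rowInsertWord r w).1 i := by
  induction w generalizing r with
  | nil => exact le_rfl
  | cons p w ih =>
    refine le_trans ?_ (ih (rowInsert_sorted hr p))
    rw [cnt_rowInsert hr]
    split_ifs <;> simp

theorem cnt_rowInsertWord_of_le {r w : List ℕ} (hr : r.Pairwise (· ≤ ·)) {i : ℕ}
    (hw : ∀ x ∈ w, i ≤ x) : cnt (rowInsertWord r w).1 i = cnt r i := by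
  induction w generalizing r with
  | nil => rfl
  | cons p w ih =>
    rw [rowInsertWord, ih (rowInsert_sorted hr p) fun x hx => hw x (by simp [hx]),
      cnt_rowInsert hr, if_neg (by simpa using hw p (by simp))]

/-- This is the last passage recursion. The labels of w smaller than i only lower existing entries
or lengthen the row. So just before the copies of i are inserted, the labels at most i fill the
longer of two initial segments: the one that they filled originally, and the one now filled by
labels smaller than i. Each copy of i then lengthens it by one, and larger labels leave it alone. -/
theorem cnt_rowInsertWord_succ {r w : List ℕ} (hr : r.Pairwise (· ≤ ·))
    (hw : w.Pairwise (· ≤ ·)) (i : ℕ) :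
    cnt (rowInsertWord r w).1 (i + 1) =
      max (cnt (rowInsertWord r w).1 i) (cnt r (i + 1)) + w.count i := by
  induction w generalizing r with
  | nil => simpa [rowInsertWord] using cnt_mono r (Nat.le_succ i)
  | cons p w ih =>
    have hr' := rowInsert_sorted hr p
    have hle := cnt_le_cnt_rowInsertWord hr' w i
    have hi := cnt_rowInsert hr p i
    rw [rowInsertWord]
    simp only
    rw [ih hr' (List.pairwise_cons.1 hw).2, cnt_rowInsert hr, List.count_cons]
    rcases lt_trichotomy i p with h | rfl | h
    · simp [h.ne', h.not_ge]
    · have h1 := cnt_rowInsertWord_of_le hr' (w := w) (i := i) (List.pairwise_cons.1 hw).1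
      rw [hi, if_neg (lt_irrefl _)] at h1
      have h2 := cnt_mono r (Nat.le_succ i)
      simp [h1]
      simp at h2
      omega
    · rw [if_pos h] at hi
      simp [h.ne, Nat.lt_succ_of_lt h]
      omega

/-- Insertion of a word into a tableau. -/
def insertWord (T : List (List ℕ)) (w : List ℕ) : List (List ℕ) :=
  w.foldl (fun T p => (tableauInsert T p).1) T

theorem row_insertWord (T : List (List ℕ)) (w : List ℕ) :
    row (insertWord T w) 0 = (rowInsertWord (row T 0) w).1 ∧
      (insertWord T w).tail = insertWord T.tail (rowInsertWord (row T 0) w).2 := by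
  induction w generalizing T with
  | nil => simp [insertWord, rowInsertWord]
  | cons p w ih =>
    have h := ih (tableauInsert T p).1
    cases T with
    | nil => simpa [insertWord, rowInsertWord, tableauInsert, rowInsert] using h
    | cons x T =>
      simp only [insertWord, List.foldl_cons, rowInsertWord, row_cons_zero, List.tail_cons,
        List.foldl_append] at h ⊢
      rw [tableauInsert] at h ⊢
      generalize rowInsert x p = y at h ⊢
      obtain ⟨r', _ | b⟩ := y <;> simpa using h

/-! ### The local rule -/

/-- Last passage times in the array `a`. -/
def lastPassage (a : ℕ → ℕ → ℕ) : ℕ → ℕ → ℕ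
  | 0, _ => 0
  | _ + 1, 0 => 0
  | i + 1, j + 1 => max (lastPassage a i (j + 1)) (lastPassage a (i + 1) j) + a i j

/-- The array of bumped labels. -/
def bumpArray (a : ℕ → ℕ → ℕ) (i j : ℕ) : ℕ :=
  min (lastPassage a i (j + 1)) (lastPassage a (i + 1) j) - lastPassage a i j

@[simp] theorem lastPassage_zero_left (a : ℕ → ℕ → ℕ) (j : ℕ) : lastPassage a 0 j = 0 := by
  rw [lastPassage]

@[simp] theorem lastPassage_zero_right (a : ℕ → ℕ → ℕ) (i : ℕ) : lastPassage a i 0 = 0 := by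
  cases i <;> rw [lastPassage]

theorem lastPassage_succ (a : ℕ → ℕ → ℕ) (i j : ℕ) :
    lastPassage a (i + 1) (j + 1) =
      max (lastPassage a i (j + 1)) (lastPassage a (i + 1) j) + a i j := by
  rw [lastPassage]

theorem lastPassage_mono_left (a : ℕ → ℕ → ℕ) (j : ℕ) : Monotone fun i => lastPassage a i j :=
  monotone_nat_of_le_succ fun i => by
    cases j with
    | zero => simp
    | succ j => simp only [lastPassage_succ]; omega

theorem lastPassage_mono_right (a : ℕ → ℕ → ℕ) (i : ℕ) : Monotone (lastPassage a i) :=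
  monotone_nat_of_le_succ fun j => by
    cases i with
    | zero => simp
    | succ i => simp only [lastPassage_succ]; omega

theorem lastPassage_swap (a : ℕ → ℕ → ℕ) (i j : ℕ) :
    lastPassage (fun x y => a y x) i j = lastPassage a j i := by
  induction i generalizing j with
  | zero => simp
  | succ i ih =>
    induction j with
    | zero => simp
    | succ j ih' => rw [lastPassage_succ, lastPassage_succ, ih, ih', max_comm]

theorem bumpArray_swap (a : ℕ → ℕ → ℕ) :
    bumpArray (fun x y => a y x) = fun x y => bumpArray a y x := by
  funext i j
  simp only [bumpArray, lastPassage_swap, min_comm]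

theorem iterate_bumpArray_swap (a : ℕ → ℕ → ℕ) (r : ℕ) :
    bumpArray^[r] (fun x y => a y x) = fun x y => (bumpArray^[r] a) y x := by
  induction r generalizing a with
  | zero => rfl
  | succ r ih => rw [Function.iterate_succ_apply, bumpArray_swap, ih, Function.iterate_succ_apply]

/-- In terms of tableaux this contains column strictness: a row has at most as many labels below i +
1 as the row above has below i. The two bounds support each other in the induction: both neighbours
of (i+1, j+1) are at most L(i,j), and the bumped entry adds exactly the difference to the minimum.
-/
theorem lastPassage_bumpArray_le (a : ℕ → ℕ → ℕ) (i j : ℕ) :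
    lastPassage (bumpArray a) (i + 1) (j + 1) ≤
      min (lastPassage a i (j + 1)) (lastPassage a (i + 1) j) := by
  have step : ∀ i j, lastPassage (bumpArray a) i (j + 1) ≤ lastPassage a i j →
      lastPassage (bumpArray a) (i + 1) j ≤ lastPassage a i j →
      lastPassage (bumpArray a) (i + 1) (j + 1) ≤
        min (lastPassage a i (j + 1)) (lastPassage a (i + 1) j) := fun i j h h' => by
    have h0 := lastPassage_mono_right a i (Nat.le_succ j)
    have h1 := lastPassage_mono_left a j (Nat.le_succ i)
    rw [lastPassage_succ (bumpArray a), bumpArray]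
    simp only [Nat.succ_eq_add_one] at h0 h1
    omega
  induction i generalizing j with
  | zero =>
    induction j with
    | zero => exact step 0 0 (by simp) (by simp)
    | succ j ih' => exact step 0 (j + 1) (by simp) (ih'.trans (min_le_left _ _))
  | succ i ih =>
    induction j with
    | zero => exact step _ _ ((ih 0).trans (min_le_right _ _)) (by simp)
    | succ j ih' =>
      exact step _ _ ((ih _).trans (min_le_right _ _)) (ih'.trans (min_le_left _ _))

theorem lastPassage_bumpArray_le_self (a : ℕ → ℕ → ℕ) (i j : ℕ) :
    lastPassage (bumpArray a) i j ≤ lastPassage a i j := by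
  cases i with
  | zero => simp
  | succ i =>
    cases j with
    | zero => simp
    | succ j =>
      refine (lastPassage_bumpArray_le a i j).trans ((min_le_left _ _).trans ?_)
      exact lastPassage_mono_left a (j + 1) (Nat.le_succ i)

/-! ### The shapes of the growing tableaux -/

/-- Inserting column j advances every row by one column of its own array. The induction on r works
because the rows below the first form the tableau of the bumped array, into which the bumped word is
inserted. -/
theorem rows_insertWord {b : ℕ → ℕ → ℕ} {T : List (List ℕ)} {w : List ℕ} {j : ℕ}
    (hT : ∀ r, (row T r).Pairwise (· ≤ ·) ∧
      ∀ i, cnt (row T r) i = lastPassage (bumpArray^[r] b) i j)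
    (hw : w.Pairwise (· ≤ ·)) (hc : ∀ i, w.count i = b i j) (r : ℕ) :
    (row (insertWord T w) r).Pairwise (· ≤ ·) ∧
      ∀ i, cnt (row (insertWord T w) r) i = lastPassage (bumpArray^[r] b) i (j + 1) := by
  have hfirst : ∀ {b : ℕ → ℕ → ℕ} {x w : List ℕ}, x.Pairwise (· ≤ ·) →
      (∀ i, cnt x i = lastPassage b i j) → w.Pairwise (· ≤ ·) → (∀ i, w.count i = b i j) →
      ∀ i, cnt (rowInsertWord x w).1 i = lastPassage b i (j + 1) := by
    intro b x w hx hxc hw hc i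
    induction i with
    | zero => simp [cnt_zero]
    | succ i ih => rw [cnt_rowInsertWord_succ hx hw, lastPassage_succ, ih, hxc, hc]
  induction r generalizing T w b with
  | zero =>
    rw [(row_insertWord T w).1]
    exact ⟨rowInsertWord_sorted (hT 0).1 w, hfirst (hT 0).1 (hT 0).2 hw hc⟩
  | succ r ih =>
    rw [← row_tail, (row_insertWord T w).2, Function.iterate_succ_apply]
    refine ih (fun r => ?_) (rowInsertWord_bumped_sorted (hT 0).1 hw) fun i => ?_
    · rw [row_tail, ← Function.iterate_succ_apply]
      exact hT (r + 1)
    -- Labels are conserved: bumped and remaining labels together are the inserted and the old ones.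
    -- Subtracting the counts at i from those at i + 1 gives L(i,j+1) + L(i+1,j) − L(i,j) minus the
    -- maximum of the first two terms as the number of bumped i, and this is `bumpArray`.
    · have h1 := cnt_rowInsertWord_add (row T 0) w i
      have h2 := cnt_rowInsertWord_add (row T 0) w (i + 1)
      have h3 := lastPassage_mono_right b i (Nat.le_succ j)
      have h4 := lastPassage_mono_left b j (Nat.le_succ i)
      rw [hfirst (b := b) (hT 0).1 (hT 0).2 hw hc] at h1 h2
      rw [lastPassage_succ] at h2
      rw [cnt_succ, cnt_succ w, hc] at h2
      have h5 : cnt (row T 0) i = lastPassage b i j := (hT 0).2 i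
      have h6 : cnt (row T 0) (i + 1) = lastPassage b (i + 1) j := (hT 0).2 (i + 1)
      simp only [Nat.succ_eq_add_one] at h3 h4
      rw [bumpArray]
      omega

theorem foldl_biletterInsert_fst (w : List ℕ) (q : ℕ) (PQ : List (List ℕ) × List (List ℕ)) :
    ((w.map fun p => (p, q)).foldl biletterInsert PQ).1 = insertWord PQ.1 w := by
  induction w generalizing PQ with
  | nil => rfl
  | cons p w ih =>
    rw [List.map_cons, List.foldl_cons, ih]
    rfl

/-- The equality of the numbers of rows keeps the index of the new box in the range where `addBox`
places it correctly. The common k expresses that both tableaux keep the same shape. -/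
theorem foldl_biletterInsert_snd (w : List ℕ) (q : ℕ) {PQ : List (List ℕ) × List (List ℕ)}
    (h : PQ.2.length = PQ.1.length) :
    ((w.map fun p => (p, q)).foldl biletterInsert PQ).2.length = (insertWord PQ.1 w).length ∧
      ∀ r, ∃ k, (row (insertWord PQ.1 w) r).length = (row PQ.1 r).length + k ∧
        row ((w.map fun p => (p, q)).foldl biletterInsert PQ).2 r =
          row PQ.2 r ++ List.replicate k q := by
  induction w generalizing PQ with
  | nil => exact ⟨h, fun r => ⟨0, by simp [insertWord]⟩⟩
  | cons p w ih =>
    have hi : (tableauInsert PQ.1 p).2 ≤ PQ.2.length := h ▸ tableauInsert_snd_le PQ.1 p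
    have h' : (biletterInsert PQ (p, q)).2.length = (biletterInsert PQ (p, q)).1.length := by
      simp only [biletterInsert]
      rw [length_addBox hi, length_tableauInsert, h]
    obtain ⟨h1, h2⟩ := ih h'
    refine ⟨h1, fun r => ?_⟩
    obtain ⟨k, hk, hk'⟩ := h2 r
    simp only [biletterInsert] at hk hk'
    rw [row_addBox hi] at hk'
    rw [length_row_tableauInsert] at hk
    refine ⟨k + if r = (tableauInsert PQ.1 p).2 then 1 else 0, ?_, ?_⟩
    · exact hk.trans (by ring)
    · refine hk'.trans ?_
      split_ifs <;> simp [List.replicate_succ]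

theorem insertWord_perm (T : List (List ℕ)) (w : List ℕ) :
    (insertWord T w).flatten.Perm (w ++ T.flatten) := by
  induction w generalizing T with
  | nil => exact List.Perm.refl _
  | cons p w ih =>
    refine (ih _).trans ?_
    refine ((tableauInsert_perm T p).append_left w).trans ?_
    exact List.perm_middle

theorem foldl_biletterInsert_ne_nil {A B : Type*} [LinearOrder A] (w : List (A × B))
    {PQ : List (List A) × List (List B)} (h : ∀ x ∈ PQ.1, x ≠ []) (h' : ∀ x ∈ PQ.2, x ≠ []) :
    (∀ x ∈ (w.foldl biletterInsert PQ).1, x ≠ []) ∧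
      ∀ x ∈ (w.foldl biletterInsert PQ).2, x ≠ [] := by
  induction w generalizing PQ with
  | nil => exact ⟨h, h'⟩
  | cons p w ih =>
    exact ih (PQ := biletterInsert PQ p) (tableauInsert_ne_nil h _) (addBox_ne_nil h' _ _)

/-- The word `1^{a_{1j}} 2^{a_{2j}} …` of the first `m` entries of column `j`. -/
def columnWord (a : ℕ → ℕ → ℕ) (m j : ℕ) : List ℕ :=
  (List.range m).flatMap fun i => List.replicate (a i j) i

theorem columnWord_succ (a : ℕ → ℕ → ℕ) (m j : ℕ) :
    columnWord a (m + 1) j = columnWord a m j ++ List.replicate (a m j) m := by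
  simp [columnWord, List.range_succ]

theorem lt_of_mem_columnWord {a : ℕ → ℕ → ℕ} {m j x : ℕ} (h : x ∈ columnWord a m j) : x < m := by
  simp only [columnWord, List.mem_flatMap, List.mem_range, List.mem_replicate] at h
  obtain ⟨i, hi, -, rfl⟩ := h
  exact hi

theorem columnWord_sorted (a : ℕ → ℕ → ℕ) (m j : ℕ) :
    (columnWord a m j).Pairwise (· ≤ ·) := by
  induction m with
  | zero => simp [columnWord]
  | succ m ih =>
    rw [columnWord_succ, List.pairwise_append]
    refine ⟨ih, by simp [List.pairwise_replicate], fun x hx y hy => ?_⟩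
    rw [List.eq_of_mem_replicate hy]
    exact (lt_of_mem_columnWord hx).le

theorem count_columnWord (a : ℕ → ℕ → ℕ) (m j i : ℕ) :
    (columnWord a m j).count i = if i < m then a i j else 0 := by
  induction m with
  | zero => simp [columnWord]
  | succ m ih =>
    rw [columnWord_succ, List.count_append, ih, List.count_replicate]
    rcases lt_trichotomy i m with h | rfl | h
    · simp [h, h.ne', Nat.lt_succ_of_lt h]
    · simp
    · simp [h.ne, h.not_gt, show ¬ i < m + 1 by omega]

theorem length_columnWord (a : ℕ → ℕ → ℕ) (m j : ℕ) :
    (columnWord a m j).length = ∑ i ∈ Finset.range m, a i j := by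
  induction m with
  | zero => simp [columnWord]
  | succ m ih => rw [columnWord_succ, Finset.sum_range_succ]; simp [ih]

/-- The biword of the upper left `m × n` part of an array. -/
def arrayBiword (a : ℕ → ℕ → ℕ) (m n : ℕ) : List (ℕ × ℕ) :=
  (List.range n).flatMap fun j => (columnWord a m j).map fun i => (i, j)

theorem arrayBiword_succ (a : ℕ → ℕ → ℕ) (m n : ℕ) :
    arrayBiword a m (n + 1) = arrayBiword a m n ++ (columnWord a m n).map fun i => (i, n) := by
  simp [arrayBiword, List.range_succ]

/-- RSK for the upper left `m × n` part of an array. -/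
def arrayRSK (a : ℕ → ℕ → ℕ) (m n : ℕ) : List (List ℕ) × List (List ℕ) :=
  (arrayBiword a m n).foldl biletterInsert ([], [])

theorem arrayRSK_succ (a : ℕ → ℕ → ℕ) (m n : ℕ) :
    arrayRSK a m (n + 1) =
      ((columnWord a m n).map fun i => (i, n)).foldl biletterInsert (arrayRSK a m n) := by
  rw [arrayRSK, arrayBiword_succ, List.foldl_append]
  rfl

theorem arrayRSK_ne_nil (a : ℕ → ℕ → ℕ) (m n : ℕ) :
    (∀ x ∈ (arrayRSK a m n).1, x ≠ []) ∧ ∀ x ∈ (arrayRSK a m n).2, x ≠ [] :=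
  foldl_biletterInsert_ne_nil _ (by simp) (by simp)

theorem rows_arrayRSK_fst {a : ℕ → ℕ → ℕ} {m : ℕ} (ha : ∀ i j, m ≤ i → a i j = 0) (n r : ℕ) :
    (row (arrayRSK a m n).1 r).Pairwise (· ≤ ·) ∧
      ∀ i, cnt (row (arrayRSK a m n).1 r) i = lastPassage (bumpArray^[r] a) i n := by
  induction n generalizing r with
  | zero => simp [arrayRSK, arrayBiword]
  | succ n ih =>
    rw [arrayRSK_succ, foldl_biletterInsert_fst]
    refine rows_insertWord ih (columnWord_sorted a m n) (fun i => ?_) r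
    rw [count_columnWord]
    split_ifs with h
    · rfl
    · rw [ha i n (not_lt.1 h)]

theorem mem_flatten_of_mem_row {A : Type*} {T : List (List A)} {r : ℕ} {x : A}
    (h : x ∈ row T r) : x ∈ T.flatten := by
  induction T generalizing r with
  | nil => simp at h
  | cons y T ih =>
    cases r with
    | zero => simp_all
    | succ r => simp only [row_cons_succ] at h; simp [ih h]

theorem arrayRSK_fst_lt {a : ℕ → ℕ → ℕ} {m n x : ℕ} (h : x ∈ (arrayRSK a m n).1.flatten) :
    x < m := by
  induction n with
  | zero => simp [arrayRSK, arrayBiword] at h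
  | succ n ih =>
    rw [arrayRSK_succ, foldl_biletterInsert_fst, (insertWord_perm _ _).mem_iff,
      List.mem_append] at h
    exact h.elim lt_of_mem_columnWord ih

theorem length_flatten_arrayRSK_fst (a : ℕ → ℕ → ℕ) (m n : ℕ) :
    (arrayRSK a m n).1.flatten.length =
      ∑ j ∈ Finset.range n, ∑ i ∈ Finset.range m, a i j := by
  induction n with
  | zero => simp [arrayRSK, arrayBiword]
  | succ n ih =>
    rw [arrayRSK_succ, foldl_biletterInsert_fst, (insertWord_perm _ _).length_eq,
      List.length_append, ih, length_columnWord, Finset.sum_range_succ, add_comm]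

theorem length_row_arrayRSK_fst {a : ℕ → ℕ → ℕ} {m : ℕ} (ha : ∀ i j, m ≤ i → a i j = 0)
    (n r : ℕ) : (row (arrayRSK a m n).1 r).length = lastPassage (bumpArray^[r] a) m n := by
  rw [← (rows_arrayRSK_fst ha n r).2, cnt_eq_length]
  exact fun x hx => arrayRSK_fst_lt (mem_flatten_of_mem_row hx)

theorem length_arrayRSK (a : ℕ → ℕ → ℕ) (m n : ℕ) :
    (arrayRSK a m n).2.length = (arrayRSK a m n).1.length := by
  induction n with
  | zero => simp [arrayRSK, arrayBiword]
  | succ n ih =>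
    rw [arrayRSK_succ, foldl_biletterInsert_fst]
    exact (foldl_biletterInsert_snd _ n ih).1

/-- The labels below j in a row of Q mark the boxes created by the first j columns, so their number
is the length of that row of P at that time. -/
theorem rows_arrayRSK_snd {a : ℕ → ℕ → ℕ} {m : ℕ} (ha : ∀ i j, m ≤ i → a i j = 0) (n r : ℕ) :
    (row (arrayRSK a m n).2 r).Pairwise (· ≤ ·) ∧
      (∀ x ∈ row (arrayRSK a m n).2 r, x < n) ∧
      (row (arrayRSK a m n).2 r).length = lastPassage (bumpArray^[r] a) m n ∧
      ∀ j, cnt (row (arrayRSK a m n).2 r) j = lastPassage (bumpArray^[r] a) m (min j n) := by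
  induction n with
  | zero => simp [arrayRSK, arrayBiword]
  | succ n ih =>
    obtain ⟨h1, h2, h3, h4⟩ := ih
    obtain ⟨k, hk, hk'⟩ :=
      (foldl_biletterInsert_snd (columnWord a m n) n (length_arrayRSK a m n)).2 r
    rw [← arrayRSK_succ] at hk'
    rw [← foldl_biletterInsert_fst (q := n), ← arrayRSK_succ, length_row_arrayRSK_fst ha,
      length_row_arrayRSK_fst ha] at hk
    rw [hk']
    have hlt : ∀ x ∈ row (arrayRSK a m n).2 r ++ List.replicate k n, x < n + 1 := by
      intro x hx
      rcases List.mem_append.1 hx with hx | hx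
      · exact (h2 x hx).trans (Nat.lt_succ_self n)
      · rw [List.eq_of_mem_replicate hx]
        exact Nat.lt_succ_self n
    have hlen : (row (arrayRSK a m n).2 r ++ List.replicate k n).length =
        lastPassage (bumpArray^[r] a) m (n + 1) := by
      rw [List.length_append, h3, hk, List.length_replicate]
    refine ⟨?_, hlt, hlen, fun j => ?_⟩
    · rw [List.pairwise_append]
      refine ⟨h1, by simp [List.pairwise_replicate], fun x hx y hy => ?_⟩
      rw [List.eq_of_mem_replicate hy]
      exact (h2 x hx).le
    · rcases le_or_gt j n with h | h
      · rw [cnt_append, h4, min_eq_left h, min_eq_left (by omega),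
          cnt_eq_zero (r := List.replicate k n) fun x hx => by
            rw [List.eq_of_mem_replicate hx]; exact h, add_zero]
      · rw [min_eq_right (by omega), ← hlen, cnt_eq_length fun x hx => (hlt x hx).trans_le h]

/-- This is read off from the tableaux: the labels of P are below m, so counting the labels below
any i ≥ m gives the whole row. -/
theorem lastPassage_min_left {a : ℕ → ℕ → ℕ} {m : ℕ} (ha : ∀ i j, m ≤ i → a i j = 0) (r i j : ℕ) :
    lastPassage (bumpArray^[r] a) (min i m) j = lastPassage (bumpArray^[r] a) i j := by
  rcases le_or_gt i m with h | h
  · rw [min_eq_left h]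
  · rw [min_eq_right h.le, ← (rows_arrayRSK_fst ha j r).2, ← (rows_arrayRSK_fst ha j r).2]
    rw [cnt_eq_length, cnt_eq_length]
    · exact fun x hx => (arrayRSK_fst_lt (mem_flatten_of_mem_row hx)).trans h
    · exact fun x hx => arrayRSK_fst_lt (mem_flatten_of_mem_row hx)

/-- Transposition of the array exchanges the two tableaux. -/
theorem arrayRSK_swap {a : ℕ → ℕ → ℕ} {m n : ℕ} (hm : ∀ i j, m ≤ i → a i j = 0)
    (hn : ∀ i j, n ≤ j → a i j = 0) :
    arrayRSK (fun i j => a j i) n m = (arrayRSK a m n).swap := by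
  have hm' : ∀ i j, n ≤ i → (fun i j => a j i) i j = 0 := fun i j h => hn j i h
  refine Prod.ext (eq_of_rows_eq (arrayRSK_ne_nil _ _ _).1 (arrayRSK_ne_nil _ _ _).2 fun r => ?_)
    (eq_of_rows_eq (arrayRSK_ne_nil _ _ _).2 (arrayRSK_ne_nil _ _ _).1 fun r => ?_)
  -- Rows of P count L(i,n) and rows of Q count L(m,j), so the symmetry of the local rule matches
  -- them.
  · refine eq_of_cnt_eq (rows_arrayRSK_fst hm' m r).1 (rows_arrayRSK_snd hm n r).1 fun i => ?_
    rw [Prod.fst_swap, (rows_arrayRSK_fst hm' m r).2, (rows_arrayRSK_snd hm n r).2.2.2, ← lastPassage_min_left hm',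
      iterate_bumpArray_swap, lastPassage_swap]
  · refine eq_of_cnt_eq (rows_arrayRSK_snd hm' m r).1 (rows_arrayRSK_fst hm n r).1 fun i => ?_
    rw [Prod.snd_swap, (rows_arrayRSK_fst hm n r).2, (rows_arrayRSK_snd hm' m r).2.2.2,
      iterate_bumpArray_swap, lastPassage_swap, lastPassage_min_left hm]

/-! ### Incrementing a dominating entry -/

/-- The array `a` with the entry `(k, l)` incremented. -/
def increment (a : ℕ → ℕ → ℕ) (k l i j : ℕ) : ℕ := a i j + if i = k ∧ j = l then 1 else 0

theorem lastPassage_le_sum (a : ℕ → ℕ → ℕ) (i j : ℕ) :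
    lastPassage a i j ≤ ∑ x ∈ Finset.range i ×ˢ Finset.range j, a x.1 x.2 := by
  induction i generalizing j with
  | zero => simp
  | succ i ih =>
    induction j with
    | zero => simp
    | succ j ih' =>
      have h1 : ∑ x ∈ Finset.range i ×ˢ Finset.range (j + 1), a x.1 x.2 + a i j ≤
          ∑ x ∈ Finset.range (i + 1) ×ˢ Finset.range (j + 1), a x.1 x.2 := by
        rw [Finset.sum_product, Finset.sum_product, Finset.sum_range_succ]
        exact Nat.add_le_add_left
          (Finset.single_le_sum (f := fun y => a i y) (fun _ _ => Nat.zero_le _) (by simp)) _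
      have h2 : ∑ x ∈ Finset.range (i + 1) ×ˢ Finset.range j, a x.1 x.2 + a i j ≤
          ∑ x ∈ Finset.range (i + 1) ×ˢ Finset.range (j + 1), a x.1 x.2 := by
        rw [Finset.sum_product_right, Finset.sum_product_right, Finset.sum_range_succ]
        exact Nat.add_le_add_left
          (Finset.single_le_sum (f := fun y => a y j) (fun _ _ => Nat.zero_le _) (by simp)) _
      have := ih (j + 1)
      rw [lastPassage_succ]
      omega

theorem sum_row_le_lastPassage (a : ℕ → ℕ → ℕ) (k j : ℕ) :
    ∑ y ∈ Finset.range j, a k y ≤ lastPassage a (k + 1) j := by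
  induction j with
  | zero => simp
  | succ j ih => rw [Finset.sum_range_succ, lastPassage_succ]; omega

theorem sum_column_le_lastPassage (a : ℕ → ℕ → ℕ) (l i : ℕ) :
    ∑ x ∈ Finset.range i, a x l ≤ lastPassage a i (l + 1) := by
  rw [← lastPassage_swap]
  exact sum_row_le_lastPassage (fun x y => a y x) l i

/-- To the right of (k,l) in row k the maximum is attained by the left neighbour, since that is at
least L(k+1,l+1), which bounds all values above; similarly in column l. Hence the increment survives
each maximum on the boundary of the quadrant, and inside it both arguments grow. -/
theorem lastPassage_increment {a : ℕ → ℕ → ℕ} {k l : ℕ}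
    (h1 : ∀ i, lastPassage a i l ≤ lastPassage a (k + 1) (l + 1))
    (h2 : ∀ j, lastPassage a k j ≤ lastPassage a (k + 1) (l + 1)) (i j : ℕ) :
    lastPassage (increment a k l) i j = lastPassage a i j + if k < i ∧ l < j then 1 else 0 := by
  induction i generalizing j with
  | zero => simp
  | succ i ih =>
    induction j with
    | zero => simp
    | succ j ih' =>
      rw [lastPassage_succ, lastPassage_succ, ih, ih', increment]
      by_cases hi : i < k
      · rw [if_neg (by omega), if_neg (by omega), if_neg (by omega), if_neg (by omega)]
        rfl
      by_cases hj : j < l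
      · rw [if_neg (by omega), if_neg (by omega), if_neg (by omega), if_neg (by omega)]
        rfl
      rw [if_pos (c := k < i + 1 ∧ l < j + 1) (by omega)]
      rcases eq_or_ne i k with rfl | hik <;> rcases eq_or_ne j l with rfl | hjl
      · simp; omega
      · have e1 := h2 (j + 1)
        have e2 := lastPassage_mono_right a (i + 1) (show l + 1 ≤ j by omega)
        rw [if_neg (by omega), if_pos (by omega), if_neg (by omega)]
        omega
      · have e1 := h1 (i + 1)
        have e2 := lastPassage_mono_left a (j + 1) (show k + 1 ≤ i by omega)
        simp only at e2
        rw [if_pos (by omega), if_neg (by omega), if_neg (by omega)]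
        omega
      · rw [if_pos (by omega), if_pos (by omega), if_neg (by omega)]
        omega

/-- On the boundary of the quadrant the minimum is attained by the neighbour that has not changed.
Inside it, the minimum and the subtracted term both grow by one. -/
theorem bumpArray_increment {a : ℕ → ℕ → ℕ} {k l : ℕ}
    (h1 : ∀ i, lastPassage a i l ≤ lastPassage a (k + 1) (l + 1))
    (h2 : ∀ j, lastPassage a k j ≤ lastPassage a (k + 1) (l + 1)) :
    bumpArray (increment a k l) = bumpArray a := by
  funext i j
  simp only [bumpArray, lastPassage_increment h1 h2]
  by_cases hi : i < k
  · rw [if_neg (by omega), if_neg (by omega), if_neg (by omega)]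
    rfl
  by_cases hj : j < l
  · rw [if_neg (by omega), if_neg (by omega), if_neg (by omega)]
    rfl
  rcases eq_or_ne i k with rfl | hik <;> rcases eq_or_ne j l with rfl | hjl
  · simp
  · have e1 := h2 (j + 1)
    have e2 := lastPassage_mono_right a (i + 1) (show l + 1 ≤ j by omega)
    rw [if_neg (by omega), if_pos (by omega), if_neg (by omega)]
    omega
  · have e1 := h1 (i + 1)
    have e2 := lastPassage_mono_left a (j + 1) (show k + 1 ≤ i by omega)
    simp only at e2
    rw [if_pos (by omega), if_neg (by omega), if_neg (by omega)]
    omega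
  · rw [if_pos (by omega), if_pos (by omega), if_pos (by omega)]
    omega

/-- If row `k` and column `l` contain at least the whole weight, then the last passage times to the
left of column `l` are bounded by the one at `(k, l)`. -/
theorem lastPassage_left_le {a : ℕ → ℕ → ℕ} {m n k l : ℕ} (hk : k < m) (hl : l < n)
    (hm : ∀ i j, m ≤ i → a i j = 0)
    (h : ∑ x ∈ Finset.range m ×ˢ Finset.range n, a x.1 x.2 ≤
      ∑ j ∈ Finset.range n, a k j + ∑ i ∈ Finset.range m, a i l) (i : ℕ) :
    lastPassage a i l ≤ lastPassage a (k + 1) (l + 1) := by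
  -- The array vanishes from row m on, so the values there are already reached at m.
  have e0 : lastPassage a i l ≤ lastPassage a m l := by
    have e := lastPassage_min_left hm 0 i l
    exact e.symm.le.trans (lastPassage_mono_left a l (min_le_right i m))
  refine e0.trans ((lastPassage_le_sum a m l).trans
    (le_trans ?_ (sum_row_le_lastPassage a k (l + 1))))
  -- The total splits into the parts left of, in and right of column l. Cancelling column l in the
  -- hypothesis and bounding the right part of row k by everything to the right shows that the left
  -- part is at most the sum of row k up to column l.
  have e1 : ∑ x ∈ Finset.range m ×ˢ Finset.range n, a x.1 x.2 =
      ∑ x ∈ Finset.range m ×ˢ Finset.range l, a x.1 x.2 + ∑ i ∈ Finset.range m, a i l +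
        ∑ j ∈ Finset.Ico (l + 1) n, ∑ i ∈ Finset.range m, a i j := by
    rw [Finset.sum_product_right, Finset.sum_product_right, ← Finset.sum_range_succ,
      Finset.sum_range_add_sum_Ico _ (by omega)]
  have e2 : ∑ j ∈ Finset.range n, a k j =
      ∑ j ∈ Finset.range (l + 1), a k j + ∑ j ∈ Finset.Ico (l + 1) n, a k j := by
    rw [Finset.sum_range_add_sum_Ico _ (by omega)]
  have e3 : ∑ j ∈ Finset.Ico (l + 1) n, a k j ≤
      ∑ j ∈ Finset.Ico (l + 1) n, ∑ i ∈ Finset.range m, a i j :=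
    Finset.sum_le_sum fun j _ =>
      Finset.single_le_sum (f := fun i => a i j) (fun _ _ => Nat.zero_le _) (by simpa using hk)
  omega

/-! ### Bitableaux over arbitrary alphabets -/

section Bitableaux

variable {A A' B B' : Type*}

/-- The minor of the generic matrix whose rows and columns are given by a list of pairs. -/
noncomputable def listMinor (L : List (A × B)) : MvPolynomial (A × B) ℂ :=
  Matrix.det (Matrix.of fun a b : Fin L.length => MvPolynomial.X ((L.get a).1, (L.get b).2))

/-- The bitableau of a pair of tableaux. -/
noncomputable def pairBitableau (PQ : List (List A) × List (List B)) : MvPolynomial (A × B) ℂ :=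
  ∏ c ∈ Finset.range (PQ.1.headD []).length,
    listMinor ((tableauColumn PQ.1 c).zip (tableauColumn PQ.2 c))

theorem listMinor_singleton (k : A) (l : B) : listMinor [(k, l)] = MvPolynomial.X (k, l) := by
  rw [listMinor]
  exact Matrix.det_fin_one _

theorem rename_listMinor (f : A → A') (g : B → B') (L : List (A × B)) :
    MvPolynomial.rename (Prod.map f g) (listMinor L) = listMinor (L.map (Prod.map f g)) := by
  have h : L.length = (L.map (Prod.map f g)).length := by simp
  rw [listMinor, listMinor, AlgHom.map_det, ← Matrix.det_submatrix_equiv_self (finCongr h)]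
  congr 1
  ext1 a b
  simp

theorem rename_swap_listMinor (L : List (A × B)) :
    MvPolynomial.rename Prod.swap (listMinor L) = listMinor (L.map Prod.swap) := by
  have h : L.length = (L.map Prod.swap).length := by simp
  rw [listMinor, listMinor, AlgHom.map_det, ← Matrix.det_submatrix_equiv_self (finCongr h),
    ← Matrix.det_transpose]
  congr 1
  ext1 a b
  simp

theorem tableauColumn_map (f : A → A') (T : List (List A)) (c : ℕ) :
    tableauColumn (T.map (List.map f)) c = (tableauColumn T c).map f := by
  simp [tableauColumn, List.filterMap_map, List.map_filterMap]

theorem rename_pairBitableau (f : A → A') (g : B → B') (PQ : List (List A) × List (List B)) :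
    MvPolynomial.rename (Prod.map f g) (pairBitableau PQ) = pairBitableau (mapPair f g PQ) := by
  have h : ((PQ.1.map (List.map f)).headD []).length = (PQ.1.headD []).length := by
    cases PQ.1 <;> simp
  rw [pairBitableau, pairBitableau, map_prod]
  simp only [mapPair, h, rename_listMinor, tableauColumn_map, List.zip_map]

/-- Minors are invariant under transposition. The hypothesis is needed because the number of factors
is taken from the first row of the first tableau. -/
theorem pairBitableau_swap (PQ : List (List A) × List (List B))
    (h : (row PQ.1 0).length = (row PQ.2 0).length) :
    pairBitableau PQ.swap = MvPolynomial.rename Prod.swap (pairBitableau PQ) := by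
  rw [pairBitableau, pairBitableau, map_prod]
  simp only [Prod.fst_swap, Prod.snd_swap, headD_eq_row, h, rename_swap_listMinor, List.zip_swap]

theorem tableauColumn_eq (T : List (List A)) (c : ℕ) :
    tableauColumn T c = (row T 0)[c]?.toList ++ tableauColumn T.tail c := by
  cases T with
  | nil => simp [tableauColumn]
  | cons x T =>
    simp only [tableauColumn, row_cons_zero, List.tail_cons, List.filterMap_cons]
    cases x[c]? <;> simp

theorem tableauColumn_eq_nil {T : List (List A)} {c : ℕ} (h : ∀ x ∈ T, x.length ≤ c) :
    tableauColumn T c = [] := by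
  simpa [tableauColumn, List.filterMap_eq_nil_iff] using h

theorem getElem?_take_cons_drop_of_lt {x : List A} {t c : ℕ} (k : A) (h : t ≤ x.length)
    (hc : c < t) : (x.take t ++ k :: x.drop t)[c]? = x[c]? := by
  rw [List.getElem?_append_left (by simp; omega), List.getElem?_take_of_lt hc]

theorem getElem?_take_cons_drop_self {x : List A} {t : ℕ} (k : A) (h : t ≤ x.length) :
    (x.take t ++ k :: x.drop t)[t]? = some k := by
  rw [List.getElem?_append_right (by simp)]
  simp [h]

theorem getElem?_take_cons_drop_add {x : List A} {t : ℕ} (k : A) (c : ℕ) (h : t ≤ x.length) :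
    (x.take t ++ k :: x.drop t)[t + (c + 1)]? = x[t + c]? := by
  rw [List.getElem?_append_right (by simp)]
  simp [h]

/-- Adjoining a column of height one to both tableaux multiplies the bitableau by a variable. -/
theorem pairBitableau_insert {P P' : List (List A)} {Q Q' : List (List B)} {t : ℕ} {k : A} {l : B}
    (hP : row P' 0 = (row P 0).take t ++ k :: (row P 0).drop t)
    (hQ : row Q' 0 = (row Q 0).take t ++ l :: (row Q 0).drop t)
    (hPt : P'.tail = P.tail) (hQt : Q'.tail = Q.tail)
    (hP1 : ∀ x ∈ P.tail, x.length ≤ t) (hQ1 : ∀ x ∈ Q.tail, x.length ≤ t)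
    (htP : t ≤ (row P 0).length) (htQ : t ≤ (row Q 0).length) :
    pairBitableau (P', Q') = MvPolynomial.X (k, l) * pairBitableau (P, Q) := by
  obtain ⟨N, hN⟩ := Nat.exists_eq_add_of_le htP
  have hN' : (row P' 0).length = t + (N + 1) := by
    rw [hP]
    simp
    omega
  have hP2 : ∀ c, tableauColumn P.tail (t + c) = [] := fun c =>
    tableauColumn_eq_nil fun x hx => (hP1 x hx).trans (Nat.le_add_right _ _)
  have hQ2 : ∀ c, tableauColumn Q.tail (t + c) = [] := fun c =>
    tableauColumn_eq_nil fun x hx => (hQ1 x hx).trans (Nat.le_add_right _ _)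
  simp only [pairBitableau, headD_eq_row, hN', hN]
  -- The columns before t are unchanged. From t on all columns have height at most one, since the
  -- lower rows end by then; there a column (k | l) appears and the others are shifted by one.
  rw [Finset.prod_range_add _ t (N + 1), Finset.prod_range_succ' _ N, Finset.prod_range_add _ t N]
  have h1 : ∀ c ∈ Finset.range t,
      listMinor ((tableauColumn P' c).zip (tableauColumn Q' c)) =
        listMinor ((tableauColumn P c).zip (tableauColumn Q c)) := fun c hc => by
    rw [tableauColumn_eq P', tableauColumn_eq Q', tableauColumn_eq P, tableauColumn_eq Q, hPt, hQt,
      hP, hQ, getElem?_take_cons_drop_of_lt k htP (Finset.mem_range.1 hc),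
      getElem?_take_cons_drop_of_lt l htQ (Finset.mem_range.1 hc)]
  have h2 : ∀ c ∈ Finset.range N,
      listMinor ((tableauColumn P' (t + (c + 1))).zip (tableauColumn Q' (t + (c + 1)))) =
        listMinor ((tableauColumn P (t + c)).zip (tableauColumn Q (t + c))) := fun c _ => by
    rw [tableauColumn_eq P', tableauColumn_eq Q', tableauColumn_eq P, tableauColumn_eq Q, hPt, hQt,
      hP, hQ, getElem?_take_cons_drop_add k c htP, getElem?_take_cons_drop_add l c htQ, hP2, hP2, hQ2, hQ2]
  have h3 : listMinor ((tableauColumn P' (t + 0)).zip (tableauColumn Q' (t + 0))) =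
      MvPolynomial.X (k, l) := by
    rw [tableauColumn_eq P', tableauColumn_eq Q', hPt, hQt, hP2, hQ2, add_zero,
      hP, hQ, getElem?_take_cons_drop_self k htP, getElem?_take_cons_drop_self l htQ]
    exact listMinor_singleton k l
  rw [Finset.prod_congr rfl h1, Finset.prod_congr rfl h2, h3]
  ring

end Bitableaux

/-! ### Multiplication of a bitableau by a variable -/

theorem pairwise_take_cons_drop {x : List ℕ} (hx : x.Pairwise (· ≤ ·)) {k t : ℕ}
    (h1 : cnt x k ≤ t) (h2 : t ≤ cnt x (k + 1)) :
    (x.take t ++ k :: x.drop t).Pairwise (· ≤ ·) := by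
  induction x generalizing t with
  | nil => simp
  | cons a x ih =>
    have hx' := List.pairwise_cons.1 hx
    cases t with
    | zero =>
      refine List.pairwise_cons.2 ⟨fun y hy => ?_, hx⟩
      have : ∀ y ∈ a :: x, k ≤ y := by
        simpa only [cnt, Nat.le_zero, List.countP_eq_zero, decide_eq_true_eq, not_lt] using h1
      exact this y hy
    | succ t =>
      have hak : a ≤ k := by
        by_contra hak
        have : cnt (a :: x) (k + 1) = 0 := cnt_eq_zero fun y hy => by
          rcases List.mem_cons.1 hy with rfl | hy
          · omega
          · exact (Nat.succ_le_of_lt (not_le.1 hak)).trans (hx'.1 y hy)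
        omega
      simp only [cnt_cons] at h1 h2
      rw [if_pos (by omega)] at h2
      have h1' : cnt x k ≤ t := by
        by_cases h : a < k
        · simp [h] at h1; omega
        · have : cnt x k = 0 := cnt_eq_zero fun y hy => (not_lt.1 h).trans (hx'.1 y hy)
          omega
      refine List.pairwise_cons.2 ⟨fun y hy => ?_, ih hx'.2 h1' (by omega)⟩
      rcases List.mem_append.1 hy with hy | hy
      · exact hx'.1 y (List.mem_of_mem_take hy)
      · rcases List.mem_cons.1 hy with rfl | hy
        · exact hak
        · exact hx'.1 y (List.mem_of_mem_drop hy)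

/-- The new k may be regarded as inserted at either end of the block of labels k, or anywhere inside
it. This freedom in t allows a common column to be chosen in P and Q. -/
theorem eq_take_cons_drop {x y : List ℕ} (hx : x.Pairwise (· ≤ ·)) (hy : y.Pairwise (· ≤ ·))
    {k t : ℕ} (h1 : cnt x k ≤ t) (h2 : t ≤ cnt x (k + 1))
    (h : ∀ i, cnt y i = cnt x i + if k < i then 1 else 0) :
    y = x.take t ++ k :: x.drop t := by
  refine eq_of_cnt_eq hy (pairwise_take_cons_drop hx h1 h2) fun i => ?_
  rw [cnt_perm (List.perm_middle (a := k)), cnt_cons, List.take_append_drop, h]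

theorem bumpArray_iterate_lastPassage_le (a : ℕ → ℕ → ℕ) (r i j : ℕ) :
    lastPassage (bumpArray^[r + 1] a) i j ≤ lastPassage (bumpArray a) i j := by
  induction r with
  | zero => exact le_rfl
  | succ r ih =>
    rw [Function.iterate_succ_apply']
    exact (lastPassage_bumpArray_le_self _ i j).trans ih

theorem mem_eq_row {A : Type*} {T : List (List A)} {x : List A} (h : x ∈ T) :
    ∃ r, x = row T r := by
  obtain ⟨r, hr, rfl⟩ := List.getElem_of_mem h
  exact ⟨r, by simp [row, hr]⟩

/-- If row `k` and column `l` of the array contain at least the whole weight, then incrementing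
the entry `(k, l)` multiplies the bitableau by the variable `z_kl`. -/
theorem pairBitableau_increment {a : ℕ → ℕ → ℕ} {m n k l : ℕ} (hk : k < m) (hl : l < n)
    (hm : ∀ i j, m ≤ i → a i j = 0) (hn : ∀ i j, n ≤ j → a i j = 0)
    (h : ∑ x ∈ Finset.range m ×ˢ Finset.range n, a x.1 x.2 ≤
      ∑ j ∈ Finset.range n, a k j + ∑ i ∈ Finset.range m, a i l) :
    pairBitableau (arrayRSK (increment a k l) m n) =
      MvPolynomial.X (k, l) * pairBitableau (arrayRSK a m n) := by
  have h1 := lastPassage_left_le hk hl hm h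
  have h2 : ∀ j, lastPassage a k j ≤ lastPassage a (k + 1) (l + 1) := fun j => by
    rw [← lastPassage_swap, ← lastPassage_swap a (l + 1)]
    refine lastPassage_left_le hl hk (fun i j hi => hn j i hi) ?_ j
    have h' := h
    rw [Finset.sum_product_right] at h'
    rw [Finset.sum_product]
    exact h'.trans (add_comm _ _).le
  have hm' : ∀ i j, m ≤ i → increment a k l i j = 0 := fun i j hi => by
    rw [increment, hm i j hi, if_neg (by omega)]
  have hb : ∀ r, bumpArray^[r + 1] (increment a k l) = bumpArray^[r + 1] a := fun r => by
    rw [Function.iterate_succ_apply, Function.iterate_succ_apply, bumpArray_increment h1 h2]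
  have hP := rows_arrayRSK_fst hm n
  have hQ := rows_arrayRSK_snd hm n
  have hP' := rows_arrayRSK_fst hm' n
  have hQ' := rows_arrayRSK_snd hm' n
  have hlP := length_row_arrayRSK_fst hm n
  have hrow := sum_row_le_lastPassage a k n
  have hcol := sum_column_le_lastPassage a l m
  -- the second row is short
  have hshort : lastPassage a m n + lastPassage (bumpArray a) m n ≤
      ∑ x ∈ Finset.range m ×ˢ Finset.range n, a x.1 x.2 := by
    have e := length_flatten_arrayRSK_fst a m n
    rw [Finset.sum_product_right, ← e]
    have e0 := hlP 0
    have e1 := hlP 1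
    simp only [Function.iterate_zero, id_eq, Function.iterate_one] at e0 e1
    rw [← e0, ← e1]
    rcases (arrayRSK a m n).1 with _ | ⟨x, _ | ⟨y, T⟩⟩
    · simp
    · simp [row]
    · simp [row]
  have hmn1 := lastPassage_mono_left a n (show k + 1 ≤ m by omega)
  have hmn2 := lastPassage_mono_right a m (show l + 1 ≤ n by omega)
  have hkn := lastPassage_mono_right a (k + 1) (show l + 1 ≤ n by omega)
  have hml := lastPassage_mono_left a (l + 1) (show k + 1 ≤ m by omega)
  have hkk := lastPassage_mono_left a n (show k ≤ k + 1 by omega)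
  have hll := lastPassage_mono_right a m (show l ≤ l + 1 by omega)
  have h1m := h1 m
  have h2n := h2 n
  simp only at hmn1 hml hkk
  have hP0 := hP 0
  have hQ0 := hQ 0
  have hP0' := hP' 0
  have hQ0' := hQ' 0
  have hlP0 := hlP 0
  simp only [Function.iterate_zero, id_eq, lastPassage_increment h1 h2] at hP0 hQ0 hP0' hQ0' hlP0
  -- The admissible t run from L(k,n) to L(k+1,n) for P and from L(m,l) to L(m,l+1) for Q, and
  -- L(k+1,l+1) separates the lower ends from the upper ones, so the smaller upper end is
  -- admissible. The two upper ends sum to at least the weight and the larger is at most the length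
  -- L(m,n) of the first row, so by `hshort` the smaller is at least the length of the second row.
  refine pairBitableau_insert (P := (arrayRSK a m n).1) (Q := (arrayRSK a m n).2)
    (P' := (arrayRSK (increment a k l) m n).1) (Q' := (arrayRSK (increment a k l) m n).2)
    (t := min (lastPassage a (k + 1) n) (lastPassage a m (l + 1))) ?_ ?_ ?_ ?_ ?_ ?_ ?_ ?_
  · refine eq_take_cons_drop hP0.1 hP0'.1 ?_ ?_ fun i => ?_
    · rw [hP0.2]; omega
    · rw [hP0.2]; omega
    · rw [hP0.2, hP0'.2]
      simp [hl]
  · refine eq_take_cons_drop hQ0.1 hQ0'.1 ?_ ?_ fun j => ?_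
    · rw [hQ0.2.2.2, min_eq_left hl.le]; omega
    · rw [hQ0.2.2.2, min_eq_left (show l + 1 ≤ n from hl)]; omega
    · rw [hQ0.2.2.2, hQ0'.2.2.2]
      simp [hk, hl]
  · refine eq_of_rows_eq (fun x hx => (arrayRSK_ne_nil _ _ _).1 x (List.mem_of_mem_tail hx))
      (fun x hx => (arrayRSK_ne_nil _ _ _).1 x (List.mem_of_mem_tail hx)) fun r => ?_
    rw [row_tail, row_tail]
    refine eq_of_cnt_eq (hP' _).1 (hP _).1 fun i => ?_
    rw [(hP' _).2, (hP _).2, hb]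
  · refine eq_of_rows_eq (fun x hx => (arrayRSK_ne_nil _ _ _).2 x (List.mem_of_mem_tail hx))
      (fun x hx => (arrayRSK_ne_nil _ _ _).2 x (List.mem_of_mem_tail hx)) fun r => ?_
    rw [row_tail, row_tail]
    refine eq_of_cnt_eq (hQ' _).1 (hQ _).1 fun i => ?_
    rw [(hQ' _).2.2.2, (hQ _).2.2.2, hb]
  · intro x hx
    obtain ⟨r, rfl⟩ := mem_eq_row hx
    rw [row_tail, hlP]
    have := bumpArray_iterate_lastPassage_le a r m n
    omega
  · intro x hx
    obtain ⟨r, rfl⟩ := mem_eq_row hx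
    rw [row_tail, (hQ _).2.2.1]
    have := bumpArray_iterate_lastPassage_le a r m n
    omega
  · rw [hlP0]; omega
  · rw [hQ0.2.2.1]; omega

/-! ### The diagonal coefficients -/

/-- The coefficient of `z^α` in `RSK(z^α)`. -/
noncomputable def diagCoeff {m n : ℕ} (α : Fin m × Fin n →₀ ℕ) : ℂ :=
  MvPolynomial.coeff α (bitableau (rsk α))

/-- The extension by zero of a matrix. -/
def toArray {m n : ℕ} (α : Fin m × Fin n →₀ ℕ) (i j : ℕ) : ℕ :=
  if h : i < m ∧ j < n then α (⟨i, h.1⟩, ⟨j, h.2⟩) else 0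

@[simp] theorem toArray_val {m n : ℕ} (α : Fin m × Fin n →₀ ℕ) (i : Fin m) (j : Fin n) :
    toArray α i j = α (i, j) := by simp [toArray]

theorem toArray_of_le_left {m n : ℕ} (α : Fin m × Fin n →₀ ℕ) (i j : ℕ) (h : m ≤ i) :
    toArray α i j = 0 := dif_neg (by omega)

theorem toArray_of_le_right {m n : ℕ} (α : Fin m × Fin n →₀ ℕ) (i j : ℕ) (h : n ≤ j) :
    toArray α i j = 0 := dif_neg (by omega)

theorem map_val_biword {m n : ℕ} (α : Fin m × Fin n →₀ ℕ) :
    (biword α).map (Prod.map Fin.val Fin.val) = arrayBiword (toArray α) m n := by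
  simp only [biword, arrayBiword, columnWord, ← List.map_coe_finRange_eq_range, List.flatMap_map,
    List.map_flatMap, List.map_replicate, toArray_val, Prod.map_apply]

/-- Passing to labels in ℕ makes counts and arrays available; the relabeling is injective on
variables, so it preserves coefficients. -/
theorem diagCoeff_eq_array {m n : ℕ} (α : Fin m × Fin n →₀ ℕ) :
    diagCoeff α = MvPolynomial.coeff (α.mapDomain (Prod.map Fin.val Fin.val))
      (pairBitableau (arrayRSK (toArray α) m n)) := by
  have h : arrayRSK (toArray α) m n = mapPair Fin.val Fin.val (rsk α) := by
    rw [arrayRSK, ← map_val_biword]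
    exact foldl_biletterInsert_map Fin.val_strictMono _ _ ([], [])
  rw [h, ← rename_pairBitableau,
    MvPolynomial.coeff_rename_mapDomain _ (Fin.val_injective.prodMap Fin.val_injective)]
  rfl

theorem diagCoeff_swap {m n : ℕ} (α : Fin m × Fin n →₀ ℕ) :
    diagCoeff (α.mapDomain Prod.swap) = diagCoeff α := by
  have h : toArray (α.mapDomain Prod.swap) = fun i j => toArray α j i := by
    funext i j
    by_cases h : i < n ∧ j < m
    · simp only [toArray, dif_pos h, dif_pos h.symm]
      exact Finsupp.mapDomain_apply Prod.swap_injective α (⟨j, h.2⟩, ⟨i, h.1⟩)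
    · simp only [toArray, dif_neg h, dif_neg (fun h' => h (And.symm h'))]
  have hlen : (row (arrayRSK (toArray α) m n).1 0).length =
      (row (arrayRSK (toArray α) m n).2 0).length := by
    rw [length_row_arrayRSK_fst (toArray_of_le_left α),
      (rows_arrayRSK_snd (toArray_of_le_left α) n 0).2.2.1]
  rw [diagCoeff_eq_array, diagCoeff_eq_array, h,
    arrayRSK_swap (toArray_of_le_left α) (toArray_of_le_right α), pairBitableau_swap _ hlen,
    ← Finsupp.mapDomain_comp, show Prod.map Fin.val Fin.val ∘ Prod.swap =
      Prod.swap ∘ Prod.map (Fin.val (n := m)) (Fin.val (n := n)) from rfl,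
    Finsupp.mapDomain_comp, MvPolynomial.coeff_rename_mapDomain _ Prod.swap_injective]

theorem diagCoeff_add_single {m n : ℕ} (α : Fin m × Fin n →₀ ℕ) (k : Fin m) (l : Fin n)
    (h : ∑ x, α x ≤ ∑ j, α (k, j) + ∑ i, α (i, l)) :
    diagCoeff (α + Finsupp.single (k, l) 1) = diagCoeff α := by
  have ha : toArray (α + Finsupp.single (k, l) 1) = increment (toArray α) k l := by
    funext i j
    by_cases h : i < m ∧ j < n
    · simp only [increment, toArray, dif_pos h, Finsupp.add_apply, Finsupp.single_apply,
        Prod.mk.injEq, Fin.ext_iff]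
      simp only [eq_comm]
    · have := k.2
      have := l.2
      simp only [increment, toArray, dif_neg h]
      rw [if_neg (by rintro ⟨rfl, rfl⟩; simp_all)]
  rw [diagCoeff_eq_array, diagCoeff_eq_array, ha, pairBitableau_increment k.2 l.2
    (toArray_of_le_left α) (toArray_of_le_right α), Finsupp.mapDomain_add,
    Finsupp.mapDomain_single, add_comm]
  · exact MvPolynomial.coeff_X_mul _ _ _
  · simpa only [Finset.sum_product, Finset.sum_range, toArray_val, Fintype.sum_prod_type] using h

theorem diagCoeff_zero {m n : ℕ} : diagCoeff (0 : Fin m × Fin n →₀ ℕ) = 1 := by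
  have : biword (0 : Fin m × Fin n →₀ ℕ) = [] := by simp [biword]
  simp [diagCoeff, rsk, this, bitableau]

/-! ### Inserting zero rows and columns -/

theorem count_biword {m n : ℕ} (α : Fin m × Fin n →₀ ℕ) (x : Fin m × Fin n) :
    (biword α).count x = α x := by
  obtain ⟨i, j⟩ := x
  have h1 : ∀ j', ((List.finRange m).flatMap fun i' => List.replicate (α (i', j')) (i', j')).count
      (i, j) = if j' = j then α (i, j) else 0 := fun j' => by
    rw [List.count_flatMap]
    have : ∀ i', List.count (i, j) (List.replicate (α (i', j')) (i', j')) =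
        if i' = i then (if j' = j then α (i, j) else 0) else 0 := fun i' => by
      rw [List.count_replicate]
      by_cases hi : i' = i <;> by_cases hj : j' = j <;> simp [hi, hj]
    simp only [Function.comp_def, this]
    rw [← List.ofFn_eq_map, List.sum_ofFn]
    simp
  rw [biword, List.count_flatMap]
  simp only [Function.comp_def, h1]
  rw [← List.ofFn_eq_map, List.sum_ofFn]
  simp

/-- The order in which biletters are inserted. -/
def BiletterLE {A B : Type*} [LinearOrder A] [LinearOrder B] (x y : A × B) : Prop :=
  x.2 < y.2 ∨ x.2 = y.2 ∧ x.1 ≤ y.1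

theorem biword_sorted {m n : ℕ} (α : Fin m × Fin n →₀ ℕ) : (biword α).Pairwise BiletterLE := by
  rw [biword, List.pairwise_flatMap]
  refine ⟨fun j _ => ?_, (List.pairwise_lt_finRange n).imp fun {j j'} hj x hx y hy => ?_⟩
  · rw [List.pairwise_flatMap]
    refine ⟨fun i _ => ?_, (List.pairwise_lt_finRange m).imp fun {i i'} hi x hx y hy => ?_⟩
    · simp [List.pairwise_replicate, BiletterLE]
    · rw [List.eq_of_mem_replicate hx, List.eq_of_mem_replicate hy]
      exact Or.inr ⟨rfl, hi.le⟩
  · simp only [List.mem_flatMap, List.mem_replicate] at hx hy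
    obtain ⟨i, -, -, rfl⟩ := hx
    obtain ⟨i', -, -, rfl⟩ := hy
    exact Or.inl hj

/-- Both words are sorted in the same antisymmetric order and have the same multiplicities. -/
theorem biword_mapDomain {m n m' n' : ℕ} {f : Fin m → Fin m'} {g : Fin n → Fin n'}
    (hf : StrictMono f) (hg : StrictMono g) (α : Fin m × Fin n →₀ ℕ) :
    biword (α.mapDomain (Prod.map f g)) = (biword α).map (Prod.map f g) := by
  have hinj : Function.Injective (Prod.map f g) := hf.injective.prodMap hg.injective
  refine List.Perm.eq_of_pairwise (le := BiletterLE) (fun x y _ _ h h' => ?_) (biword_sorted _)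
    ?_ (List.perm_iff_count.2 fun x => ?_)
  · rcases h with h | ⟨h, h1⟩ <;> rcases h' with h' | ⟨h', h2⟩
    · exact absurd h h'.not_gt
    · exact absurd h h'.not_gt
    · exact absurd h' h.not_gt
    · exact Prod.ext (le_antisymm h1 h2) h
  · rw [List.pairwise_map]
    refine (biword_sorted α).imp fun {x y} h => ?_
    rcases h with h | ⟨h, h'⟩
    · exact Or.inl (hg h)
    · exact Or.inr ⟨congrArg g h, hf.monotone h'⟩
  · rw [count_biword]
    by_cases hx : x ∈ Set.range (Prod.map f g)
    · obtain ⟨y, rfl⟩ := hx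
      rw [Finsupp.mapDomain_apply hinj, List.count_map_of_injective _ _ hinj, count_biword]
    · rw [Finsupp.mapDomain_of_notMem_range _ _ hx, eq_comm, List.count_eq_zero]
      intro h
      obtain ⟨y, -, rfl⟩ := List.mem_map.1 h
      exact hx ⟨y, rfl⟩

theorem diagCoeff_mapDomain {m n m' n' : ℕ} {f : Fin m → Fin m'} {g : Fin n → Fin n'}
    (hf : StrictMono f) (hg : StrictMono g) (α : Fin m × Fin n →₀ ℕ) :
    diagCoeff (α.mapDomain (Prod.map f g)) = diagCoeff α := by
  have h : rsk (α.mapDomain (Prod.map f g)) = mapPair f g (rsk α) := by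
    rw [rsk, biword_mapDomain hf hg]
    exact foldl_biletterInsert_map hf g _ ([], [])
  rw [diagCoeff, h]
  exact (congrArg _ (rename_pairBitableau f g (rsk α)).symm).trans
    (MvPolynomial.coeff_rename_mapDomain _ (hf.injective.prodMap hg.injective) _ _)

/-! ### Traces on weight spaces -/

/-- The sum of the diagonal coefficients over the contingency tables with given margins. -/
noncomputable def weightTrace {a b : ℕ} (σ : Fin a → ℕ) (π : Fin b → ℕ) : ℂ :=
  ∑ α ∈ contingencyTables σ π, diagCoeff α

theorem RSK_monomial {m n : ℕ} (α : Fin m × Fin n →₀ ℕ) :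
    RSK m n (MvPolynomial.monomial α 1) = bitableau (rsk α) := by
  exact (MvPolynomial.basisMonomials (Fin m × Fin n) ℂ).constr_basis ℂ _ α

theorem trace_weightMatrix {a b : ℕ} (σ : Fin a → ℕ) (π : Fin b → ℕ) :
    (weightMatrix σ π).trace = weightTrace σ π := by
  simp only [Matrix.trace, Matrix.diag_apply, weightMatrix, Matrix.of_apply, RSK_monomial]
  exact Finset.sum_coe_sort (contingencyTables σ π) diagCoeff

theorem trace_degreeMatrix (m n d : ℕ) :
    (degreeMatrix m n d).trace = ∑ α ∈ exponents m n d, diagCoeff α := by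
  simp only [Matrix.trace, Matrix.diag_apply, degreeMatrix, Matrix.of_apply, RSK_monomial]
  exact Finset.sum_coe_sort (exponents m n d) diagCoeff

theorem mem_exponents {m n d : ℕ} {α : Fin m × Fin n →₀ ℕ} :
    α ∈ exponents m n d ↔ ∑ i, ∑ j, α (i, j) = d := by
  simp [exponents, Finset.mem_finsuppAntidiag, Fintype.sum_prod_type]

theorem mem_contingencyTables {a b : ℕ} {σ : Fin a → ℕ} {π : Fin b → ℕ}
    {α : Fin a × Fin b →₀ ℕ} :
    α ∈ contingencyTables σ π ↔ (∀ i, ∑ j, α (i, j) = σ i) ∧ ∀ j, ∑ i, α (i, j) = π j := by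
  rw [contingencyTables, Finset.mem_filter, mem_exponents, and_iff_right_iff_imp]
  intro h
  simp only [h.1]

/-- The weights of degree `d`. -/
abbrev weights (m d : ℕ) : Finset (Fin m → ℕ) := Finset.piAntidiag Finset.univ d

theorem mem_weights {m d : ℕ} {σ : Fin m → ℕ} : σ ∈ weights m d ↔ ∑ i, σ i = d := by
  simp [Finset.mem_piAntidiag]

theorem trace_degreeMatrix_eq_sum (m n d : ℕ) :
    (degreeMatrix m n d).trace = ∑ σ ∈ weights m d, ∑ π ∈ weights n d, weightTrace σ π := by
  rw [trace_degreeMatrix, ← Finset.sum_product', ← Finset.sum_fiberwise_of_maps_to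
    (t := weights m d ×ˢ weights n d)
    (g := fun α => (fun i => ∑ j, α (i, j), fun j => ∑ i, α (i, j)))]
  · refine Finset.sum_congr rfl fun p hp => ?_
    simp only [Finset.mem_product, mem_weights] at hp
    rw [weightTrace]
    refine Finset.sum_congr (Finset.ext fun α => ?_) fun _ _ => rfl
    rw [Finset.mem_filter, mem_exponents, mem_contingencyTables, Prod.ext_iff, funext_iff,
      funext_iff, and_iff_right_iff_imp]
    rintro ⟨h, -⟩
    exact (Finset.sum_congr rfl fun i _ => h i).trans hp.1
  · intro α hα
    rw [mem_exponents] at hα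
    simp only [Finset.mem_product, mem_weights]
    exact ⟨hα, by rw [Finset.sum_comm]; exact hα⟩

theorem weightTrace_swap {a b : ℕ} (σ : Fin a → ℕ) (π : Fin b → ℕ) :
    weightTrace π σ = weightTrace σ π := by
  refine (Finset.sum_nbij' (Finsupp.mapDomain Prod.swap) (Finsupp.mapDomain Prod.swap)
    ?_ ?_ ?_ ?_ ?_).symm
  · intro α hα
    rw [mem_contingencyTables] at hα ⊢
    have h : ∀ i j, α.mapDomain Prod.swap (j, i) = α (i, j) := fun i j =>
      Finsupp.mapDomain_apply Prod.swap_injective α (i, j)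
    simpa only [h] using hα.symm
  · intro α hα
    rw [mem_contingencyTables] at hα ⊢
    have h : ∀ i j, α.mapDomain Prod.swap (j, i) = α (i, j) := fun i j =>
      Finsupp.mapDomain_apply Prod.swap_injective α (i, j)
    simpa only [h] using hα.symm
  · intro α _
    rw [← Finsupp.mapDomain_comp, Prod.swap_swap_eq, Finsupp.mapDomain_id]
  · intro α _
    rw [← Finsupp.mapDomain_comp, Prod.swap_swap_eq, Finsupp.mapDomain_id]
  · exact fun α _ => (diagCoeff_swap α).symm

theorem weightTrace_zero {a b : ℕ} : weightTrace (0 : Fin a → ℕ) (0 : Fin b → ℕ) = 1 := by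
  have : contingencyTables (0 : Fin a → ℕ) (0 : Fin b → ℕ) = {0} := by
    ext α
    rw [mem_contingencyTables, Finset.mem_singleton]
    constructor
    · rintro ⟨h, -⟩
      ext ⟨i, j⟩
      exact (Finset.sum_eq_zero_iff.1 (h i)) j (Finset.mem_univ j)
    · rintro rfl
      simp
  rw [weightTrace, this, Finset.sum_singleton, diagCoeff_zero]

/-- Weights may be extended by zeros. -/
theorem weightTrace_extend {a b m n : ℕ} (f : Fin a ↪o Fin m) (g : Fin b ↪o Fin n)
    (σ : Fin a → ℕ) (π : Fin b → ℕ) :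
    weightTrace (Function.extend f σ 0) (Function.extend g π 0) = weightTrace σ π := by
  have hinj : Function.Injective (Prod.map f g) := f.injective.prodMap g.injective
  refine (Finset.sum_nbij (Finsupp.mapDomain (Prod.map f g)) ?_
    (Finsupp.mapDomain_injective hinj).injOn ?_
    fun α _ => (diagCoeff_mapDomain f.strictMono g.strictMono α).symm).symm
  · intro α hα
    rw [mem_contingencyTables] at hα ⊢
    have happ : ∀ i j, α.mapDomain (Prod.map f g) (f i, g j) = α (i, j) := fun i j =>
      Finsupp.mapDomain_apply hinj α (i, j)
    have hleft : ∀ i j, i ∉ Set.range f → α.mapDomain (Prod.map f g) (i, j) = 0 := fun i j hi =>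
      Finsupp.mapDomain_of_notMem_range _ _ (by rintro ⟨x, hx⟩; exact hi ⟨x.1, congrArg Prod.fst hx⟩)
    have hright : ∀ i j, j ∉ Set.range g → α.mapDomain (Prod.map f g) (i, j) = 0 := fun i j hi =>
      Finsupp.mapDomain_of_notMem_range _ _ (by rintro ⟨x, hx⟩; exact hi ⟨x.2, congrArg Prod.snd hx⟩)
    constructor
    · intro i
      by_cases hi : i ∈ Set.range f
      · obtain ⟨i, rfl⟩ := hi
        rw [f.injective.extend_apply, ← hα.1 i]
        exact (Fintype.sum_of_injective g g.injective _ _ (fun j hj => hright _ j hj)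
          fun j => (happ i j).symm).symm
      · rw [Function.extend_apply' _ _ _ hi]
        exact Finset.sum_eq_zero fun j _ => hleft i j hi
    · intro j
      by_cases hj : j ∈ Set.range g
      · obtain ⟨j, rfl⟩ := hj
        rw [g.injective.extend_apply, ← hα.2 j]
        exact (Fintype.sum_of_injective f f.injective _ _ (fun i hi => hleft i _ hi)
          fun i => (happ i j).symm).symm
      · rw [Function.extend_apply' _ _ _ hj]
        exact Finset.sum_eq_zero fun i _ => hright i j hj
  · intro β hβ
    rw [Finset.mem_coe, mem_contingencyTables] at hβ
    -- A vanishing margin forces the whole row of the table to vanish, and similarly for columns.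
    have hleft : ∀ i j, i ∉ Set.range f → β (i, j) = 0 := fun i j hi => by
      have h := hβ.1 i
      rw [Function.extend_apply' _ _ _ hi] at h
      exact Finset.sum_eq_zero_iff.1 h j (Finset.mem_univ j)
    have hright : ∀ i j, j ∉ Set.range g → β (i, j) = 0 := fun i j hj => by
      have h := hβ.2 j
      rw [Function.extend_apply' _ _ _ hj] at h
      exact Finset.sum_eq_zero_iff.1 h i (Finset.mem_univ i)
    refine ⟨β.comapDomain (Prod.map f g) hinj.injOn, ?_, ?_⟩
    · rw [Finset.mem_coe, mem_contingencyTables]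
      constructor
      · intro i
        rw [← f.injective.extend_apply σ 0 i, ← hβ.1]
        exact Fintype.sum_of_injective g g.injective _ _ (fun j hj => hright _ j hj) fun j => rfl
      · intro j
        rw [← g.injective.extend_apply π 0 j, ← hβ.2]
        exact Fintype.sum_of_injective f f.injective _ _ (fun i hi => hleft i _ hi) fun i => rfl
    · refine Finsupp.mapDomain_comapDomain _ hinj β fun x hx => ?_
      obtain ⟨i, j⟩ := x
      rw [Finset.mem_coe, Finsupp.mem_support_iff] at hx
      obtain ⟨i, rfl⟩ := not_not.1 fun h => hx (hleft i j h)
      obtain ⟨j, rfl⟩ := not_not.1 fun h => hx (hright _ j h)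
      exact ⟨(i, j), rfl⟩

/-- Row k and column l overlap only in the entry (k,l). -/
theorem add_le_sum_add {a b : ℕ} (α : Fin a × Fin b →₀ ℕ) (k : Fin a) (l : Fin b) :
    ∑ j, α (k, j) + ∑ i, α (i, l) ≤ ∑ i, ∑ j, α (i, j) + α (k, l) := by
  rw [← Finset.add_sum_erase _ _ (Finset.mem_univ k),
    ← Finset.add_sum_erase _ (fun i => ∑ j, α (i, j)) (Finset.mem_univ k)]
  have : ∑ i ∈ Finset.univ.erase k, α (i, l) ≤ ∑ i ∈ Finset.univ.erase k, ∑ j, α (i, j) :=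
    Finset.sum_le_sum fun i _ =>
      Finset.single_le_sum (f := fun j => α (i, j)) (fun _ _ => Nat.zero_le _) (Finset.mem_univ l)
  omega

/-- The trace is constant along the covering relations. -/
theorem weightTrace_eq_of_covers {a b : ℕ} {p q : (Fin a → ℕ) × (Fin b → ℕ)} (h : Covers p q) :
    weightTrace q.1 q.2 = weightTrace p.1 p.2 := by
  obtain ⟨k, l, h, h1, h2⟩ := h
  have hs1 : ∀ i, ∑ j, (Finsupp.single (k, l) 1 : Fin a × Fin b →₀ ℕ) (i, j) =
      (Pi.single k 1 : Fin a → ℕ) i := fun i => by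
    by_cases hi : i = k
    · subst hi
      simp [Finsupp.single_apply]
    · simp [hi]
  have hs2 : ∀ j, ∑ i, (Finsupp.single (k, l) 1 : Fin a × Fin b →₀ ℕ) (i, j) =
      (Pi.single l 1 : Fin b → ℕ) j := fun j => by
    by_cases hj : j = l
    · subst hj
      simp [Finsupp.single_apply]
    · simp [hj]
  refine (Finset.sum_nbij (fun α => α + Finsupp.single (k, l) 1) ?_ ?_ ?_ ?_).symm
  · intro α hα
    rw [mem_contingencyTables] at hα ⊢
    simp only [Finsupp.add_apply, Finset.sum_add_distrib, hs1, hs2, h1, h2, hα.1, hα.2,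
      Pi.add_apply, implies_true, and_self]
  · exact fun α _ β _ h => add_right_cancel h
  · intro β hβ
    rw [Finset.mem_coe, mem_contingencyTables] at hβ
    -- Surjectivity: at the upper margins, row k and column l together exceed the degree, so their
    -- common entry is positive.
    have hle : Finsupp.single (k, l) 1 ≤ β := by
      have h3 := add_le_sum_add β k l
      simp only [hβ.1, hβ.2, h1, h2, Pi.add_apply, Pi.single_eq_same, Finset.sum_add_distrib,
        Finset.sum_pi_single', Finset.mem_univ, if_true] at h3
      rw [Finsupp.single_le_iff]
      omega
    refine ⟨β - Finsupp.single (k, l) 1, ?_, tsub_add_cancel_of_le hle⟩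
    rw [Finset.mem_coe, mem_contingencyTables]
    obtain ⟨γ, rfl⟩ := exists_add_of_le hle
    rw [add_tsub_cancel_left]
    simp only [Finsupp.add_apply, Finset.sum_add_distrib, hs1, hs2, h1, h2,
      Pi.add_apply] at hβ
    exact ⟨fun i => by have := hβ.1 i; omega, fun j => by have := hβ.2 j; omega⟩
  · intro α hα
    rw [mem_contingencyTables] at hα
    refine (diagCoeff_add_single α k l ?_).symm
    rw [Fintype.sum_prod_type]
    simp only [hα.1, hα.2]
    exact h

/-! ### Reduction of weight pairs -/

section Reduction

variable {a b : ℕ}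

/-- Both weights have degree `d`. -/
def HasDegree (d : ℕ) (p : (Fin a → ℕ) × (Fin b → ℕ)) : Prop :=
  ∑ i, p.1 i = d ∧ ∑ j, p.2 j = d

/-- One of the weights of degree `d` has only one nonzero entry. -/
def IsConcentrated (d : ℕ) (p : (Fin a → ℕ) × (Fin b → ℕ)) : Prop :=
  (∃ k, p.1 k = d) ∨ ∃ l, p.2 l = d

/-- All entries are nonzero. -/
def IsPositive (p : (Fin a → ℕ) × (Fin b → ℕ)) : Prop := (∀ i, 0 < p.1 i) ∧ ∀ j, 0 < p.2 j

theorem le_of_hasDegree_left {d : ℕ} {p : (Fin a → ℕ) × (Fin b → ℕ)} (h : HasDegree d p)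
    (k : Fin a) : p.1 k ≤ d := by
  rw [← h.1]
  exact Finset.single_le_sum (fun _ _ => Nat.zero_le _) (Finset.mem_univ k)

theorem le_of_hasDegree_right {d : ℕ} {p : (Fin a → ℕ) × (Fin b → ℕ)} (h : HasDegree d p)
    (l : Fin b) : p.2 l ≤ d := by
  rw [← h.2]
  exact Finset.single_le_sum (fun _ _ => Nat.zero_le _) (Finset.mem_univ l)

theorem Covers.hasDegree_iff {d : ℕ} {p q : (Fin a → ℕ) × (Fin b → ℕ)} (h : Covers p q) :
    HasDegree (d + 1) q ↔ HasDegree d p := by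
  obtain ⟨k, l, -, h1, h2⟩ := h
  simp [HasDegree, h1, h2, Finset.sum_add_distrib]

theorem Covers.exists_degree {d : ℕ} {p q : (Fin a → ℕ) × (Fin b → ℕ)} (h : Covers p q)
    (hq : HasDegree d q) : ∃ e, d = e + 1 ∧ HasDegree e p := by
  cases d with
  | zero =>
    obtain ⟨k, l, -, h1, h2⟩ := h
    simp [HasDegree, h1, h2, Finset.sum_add_distrib] at hq
  | succ d => exact ⟨d, rfl, h.hasDegree_iff.1 hq⟩

/-- Subtraction of one from the entries `k` and `l`. -/
def lower (k : Fin a) (l : Fin b) (q : (Fin a → ℕ) × (Fin b → ℕ)) :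
    (Fin a → ℕ) × (Fin b → ℕ) := (q.1 - Pi.single k 1, q.2 - Pi.single l 1)

theorem lower_comm (k k' : Fin a) (l l' : Fin b) (q : (Fin a → ℕ) × (Fin b → ℕ)) :
    lower k l (lower k' l' q) = lower k' l' (lower k l q) :=
  Prod.ext tsub_right_comm tsub_right_comm

/-- The pair `q` can be lowered at `k` and `l`. -/
def CanLower (k : Fin a) (l : Fin b) (q : (Fin a → ℕ) × (Fin b → ℕ)) : Prop :=
  ∑ i, q.1 i < q.1 k + q.2 l ∧ 0 < q.1 k ∧ 0 < q.2 l

theorem single_one_le {k : Fin a} {σ : Fin a → ℕ} (h : 0 < σ k) : Pi.single k 1 ≤ σ := by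
  intro i
  by_cases hi : i = k
  · subst hi
    simpa [Nat.one_le_iff_ne_zero, Nat.pos_iff_ne_zero] using h
  · simp [hi]

/-- Lowering decreases the degree by one but the sum of the two entries by two, so the strict
inequality above is the weak one below. Positivity makes the truncated subtractions exact. -/
theorem CanLower.covers {k : Fin a} {l : Fin b} {q : (Fin a → ℕ) × (Fin b → ℕ)}
    (h : CanLower k l q) : Covers (lower k l q) q := by
  obtain ⟨h, hk, hl⟩ := h
  have h1 : q.1 = (lower k l q).1 + Pi.single k 1 :=
    (tsub_add_cancel_of_le (single_one_le hk)).symm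
  have h2 : q.2 = (lower k l q).2 + Pi.single l 1 :=
    (tsub_add_cancel_of_le (single_one_le hl)).symm
  refine ⟨k, l, ?_, h1, h2⟩
  rw [h1, h2] at h
  simp [Finset.sum_add_distrib] at h
  omega

theorem Covers.exists_canLower {p q : (Fin a → ℕ) × (Fin b → ℕ)} (h : Covers p q) :
    ∃ k l, CanLower k l q ∧ p = lower k l q := by
  obtain ⟨k, l, h, h1, h2⟩ := h
  refine ⟨k, l, ⟨?_, ?_, ?_⟩, ?_⟩
  · simp [h1, h2, Finset.sum_add_distrib]
    omega
  · simp [h1]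
  · simp [h2]
  · simp [lower, h1, h2]

theorem not_covers_of_isReduced {p q : (Fin a → ℕ) × (Fin b → ℕ)} (hq : IsReduced q.1 q.2) :
    ¬ Covers p q := by
  intro h
  obtain ⟨k, l, ⟨h, -, -⟩, -⟩ := h.exists_canLower
  have h1 := Finset.le_sup (f := q.1) (Finset.mem_univ k)
  have h2 := Finset.le_sup (f := q.2) (Finset.mem_univ l)
  rw [IsReduced] at hq
  omega

theorem exists_covers [Nonempty (Fin a)] [Nonempty (Fin b)] {d : ℕ}
    {q : (Fin a → ℕ) × (Fin b → ℕ)} (hd : HasDegree d q) (hq : ¬ IsReduced q.1 q.2) :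
    ∃ p, Covers p q := by
  obtain ⟨k, -, hk⟩ := Finset.exists_mem_eq_sup Finset.univ Finset.univ_nonempty q.1
  obtain ⟨l, -, hl⟩ := Finset.exists_mem_eq_sup Finset.univ Finset.univ_nonempty q.2
  rw [IsReduced, hk, hl, hd.1] at hq
  have h1 := le_of_hasDegree_left hd k
  have h2 := le_of_hasDegree_right hd l
  exact ⟨_, CanLower.covers (k := k) (l := l) ⟨by rw [hd.1]; omega, by omega, by omega⟩⟩

/-- The diamond property. If both indices differ, the two lowering inequalities add up to more than
2d, contradicting the degrees. If one index is shared, its entry and the degree drop by one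
together, and the shared entry is at least 2, as the two other entries sum to at most d. -/
theorem canLower_lower {d : ℕ} {k k' : Fin a} {l l' : Fin b} {q : (Fin a → ℕ) × (Fin b → ℕ)}
    (hd : HasDegree d q) (h : CanLower k l q) (h' : CanLower k' l' q) (hne : ¬(k = k' ∧ l = l')) :
    CanLower k' l' (lower k l q) := by
  have hsum := h.covers.exists_degree hd
  obtain ⟨e, rfl, he⟩ := hsum
  obtain ⟨h1, h2, h3⟩ := h
  obtain ⟨h1', h2', h3'⟩ := h'
  rw [hd.1] at h1 h1'
  have hk : k ≠ k' → q.1 k + q.1 k' ≤ e + 1 := fun hk => by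
    rw [← hd.1]
    exact Finset.add_le_sum (fun _ _ => Nat.zero_le _) (Finset.mem_univ _) (Finset.mem_univ _) hk
  have hl : l ≠ l' → q.2 l + q.2 l' ≤ e + 1 := fun hl => by
    rw [← hd.2]
    exact Finset.add_le_sum (fun _ _ => Nat.zero_le _) (Finset.mem_univ _) (Finset.mem_univ _) hl
  rw [CanLower, he.1]
  by_cases hkk : k = k' <;> by_cases hll : l = l'
  · exact absurd ⟨hkk, hll⟩ hne
  · subst hkk
    have := hl hll
    simp only [lower, Pi.sub_apply, Pi.single_eq_same, Pi.single_eq_of_ne (Ne.symm hll)]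
    omega
  · subst hll
    have := hk hkk
    simp only [lower, Pi.sub_apply, Pi.single_eq_same, Pi.single_eq_of_ne (Ne.symm hkk)]
    omega
  · have := hk hkk
    have := hl hll
    omega

open Relation in
theorem reduced_unique {d : ℕ} {p p' q : (Fin a → ℕ) × (Fin b → ℕ)} (hq : HasDegree d q)
    (hp : IsReduced p.1 p.2) (hp' : IsReduced p'.1 p'.2) (h : ReflTransGen Covers p q)
    (h' : ReflTransGen Covers p' q) : p = p' := by
  -- The degree is recorded in the relation because the diamond property needs both weights to have
  -- the same degree.
  let r : (Fin a → ℕ) × (Fin b → ℕ) → (Fin a → ℕ) × (Fin b → ℕ) → Prop := fun x y =>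
    Covers y x ∧ ∃ d, HasDegree d x
  have lift : ∀ {p q : (Fin a → ℕ) × (Fin b → ℕ)} {d : ℕ}, ReflTransGen Covers p q →
      HasDegree d q → ReflTransGen r q p := by
    intro p q d h
    induction h generalizing d with
    | refl => exact fun _ => .refl
    | tail _ hcov ih =>
      intro hd
      obtain ⟨e, -, he⟩ := hcov.exists_degree hd
      exact .head ⟨hcov, d, hd⟩ (ih he)
  have stuck : ∀ {p s : (Fin a → ℕ) × (Fin b → ℕ)}, IsReduced p.1 p.2 → ReflTransGen r p s →
      p = s := by
    intro p s hp h
    rcases h.cases_head with h | ⟨c, hc, -⟩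
    · exact h
    · exact absurd hc.1 (not_covers_of_isReduced hp)
  obtain ⟨s, hs, hs'⟩ := church_rosser (r := r) (fun x y z hxy hxz => by
    obtain ⟨hxy, d, hd⟩ := hxy
    obtain ⟨k, l, hkl, rfl⟩ := hxy.exists_canLower
    obtain ⟨k', l', hkl', rfl⟩ := hxz.1.exists_canLower
    by_cases hne : k = k' ∧ l = l'
    · obtain ⟨rfl, rfl⟩ := hne
      exact ⟨_, .refl, .refl⟩
    · obtain ⟨e, -, he⟩ := hxy.exists_degree hd
      obtain ⟨e', -, he'⟩ := hxz.1.exists_degree hd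
      refine ⟨lower k' l' (lower k l x),
        .single ⟨(canLower_lower hd hkl hkl' hne).covers, e, he⟩, .single ⟨?_, e', he'⟩⟩
      rw [lower_comm]
      exact (canLower_lower hd hkl' hkl fun h => hne ⟨h.1.symm, h.2.symm⟩).covers)
    (lift h hq) (lift h' hq)
  exact (stuck hp hs).trans (stuck hp' hs').symm

open Relation in
theorem exists_reduced [Nonempty (Fin a)] [Nonempty (Fin b)] {d : ℕ}
    {q : (Fin a → ℕ) × (Fin b → ℕ)} (hd : HasDegree d q) :
    ∃ e ≤ d, ∃ p, HasDegree e p ∧ IsReduced p.1 p.2 ∧ ReflTransGen Covers p q := by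
  induction d generalizing q with
  | zero =>
    by_cases hq : IsReduced q.1 q.2
    · exact ⟨0, le_rfl, q, hd, hq, .refl⟩
    · obtain ⟨p, hp⟩ := exists_covers hd hq
      obtain ⟨e, he, -⟩ := hp.exists_degree hd
      omega
  | succ d ih =>
    by_cases hq : IsReduced q.1 q.2
    · exact ⟨_, le_rfl, q, hd, hq, .refl⟩
    · obtain ⟨p, hp⟩ := exists_covers hd hq
      obtain ⟨e, he, s, hs, hs', hsp⟩ := ih (hp.hasDegree_iff.1 hd)
      exact ⟨e, by omega, s, hs, hs', hsp.tail hp⟩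

theorem apply_eq_zero_of_sum {d : ℕ} {σ : Fin a → ℕ} (h : ∑ i, σ i = d) {k k' : Fin a}
    (hk : σ k = d) (hne : k' ≠ k) : σ k' = 0 := by
  have := Finset.add_le_sum (f := σ) (fun _ _ => Nat.zero_le _) (Finset.mem_univ k')
    (Finset.mem_univ k) hne
  omega

/-- If σ_k' = d and the step is taken at k ≠ k', then σ_k = 0, so π_l = d: the pair is concentrated
on the other side as well, and remains so there. -/
theorem Covers.isConcentrated_iff {d : ℕ} {p q : (Fin a → ℕ) × (Fin b → ℕ)} (h : Covers p q)
    (hp : HasDegree d p) : IsConcentrated (d + 1) q ↔ IsConcentrated d p := by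
  have hq := h.hasDegree_iff.2 hp
  obtain ⟨k, l, h, h1, h2⟩ := h
  rw [hp.1] at h
  constructor
  · rintro (⟨k', hk'⟩ | ⟨l', hl'⟩)
    · left
      refine ⟨k', ?_⟩
      have := le_of_hasDegree_left hp k'
      by_cases hkk : k' = k
      · subst hkk
        simp [h1] at hk'
        exact hk'
      · simp [h1, hkk] at hk'
        omega
    · right
      refine ⟨l', ?_⟩
      have := le_of_hasDegree_right hp l'
      by_cases hll : l' = l
      · subst hll
        simp [h2] at hl'
        exact hl'
      · simp [h2, hll] at hl'
        omega
  · have hle := le_of_hasDegree_left hp k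
    have hle' := le_of_hasDegree_right hp l
    rintro (⟨k', hk'⟩ | ⟨l', hl'⟩)
    · by_cases hkk : k = k'
      · subst hkk
        left
        exact ⟨k, by simp [h1, hk']⟩
      · right
        have := apply_eq_zero_of_sum hp.1 hk' hkk
        exact ⟨l, by simp [h2]; omega⟩
    · by_cases hll : l = l'
      · subst hll
        right
        exact ⟨l, by simp [h2, hl']⟩
      · left
        have := apply_eq_zero_of_sum hp.2 hl' hll
        exact ⟨k, by simp [h1]; omega⟩

theorem Covers.isPositive {p q : (Fin a → ℕ) × (Fin b → ℕ)} (h : Covers p q)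
    (hp : IsPositive p) : IsPositive q := by
  obtain ⟨k, l, -, h1, h2⟩ := h
  exact ⟨fun i => by rw [h1]; exact Nat.add_pos_left (hp.1 i) _,
    fun j => by rw [h2]; exact Nat.add_pos_left (hp.2 j) _⟩

/-- An entry lowered to zero would force its partner to carry the whole degree. -/
theorem Covers.isPositive_of_not_isConcentrated {d : ℕ} {p q : (Fin a → ℕ) × (Fin b → ℕ)}
    (h : Covers p q) (hp : HasDegree d p) (hc : ¬ IsConcentrated d p) (hq : IsPositive q) :
    IsPositive p := by
  obtain ⟨k, l, h, h1, h2⟩ := h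
  rw [hp.1] at h
  have hle := le_of_hasDegree_left hp k
  have hle' := le_of_hasDegree_right hp l
  constructor
  · intro i
    by_cases hi : i = k
    · subst hi
      by_contra h0
      exact hc (Or.inr ⟨l, by omega⟩)
    · simpa [h1, hi] using hq.1 i
  · intro j
    by_cases hj : j = l
    · subst hj
      by_contra h0
      exact hc (Or.inl ⟨k, by omega⟩)
    · simpa [h2, hj] using hq.2 j

open Relation in
/-- What is preserved by reduction of a pair that is not concentrated. -/
theorem reduction_spec {d : ℕ} {p q : (Fin a → ℕ) × (Fin b → ℕ)}
    (h : ReflTransGen Covers p q) (hq : HasDegree d q) :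
    ∃ e ≤ d, HasDegree e p ∧ weightTrace q.1 q.2 = weightTrace p.1 p.2 ∧
      (IsConcentrated d q ↔ IsConcentrated e p) ∧
      (¬ IsConcentrated e p → (IsPositive q ↔ IsPositive p)) := by
  induction h generalizing d with
  | refl => exact ⟨d, le_rfl, hq, rfl, Iff.rfl, fun _ => Iff.rfl⟩
  | tail _ hcov ih =>
    obtain ⟨d, rfl, hd⟩ := hcov.exists_degree hq
    obtain ⟨e, he, h1, h2, h3, h4⟩ := ih hd
    refine ⟨e, by omega, h1, (weightTrace_eq_of_covers hcov).trans h2,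
      (hcov.isConcentrated_iff hd).trans h3, fun hc => ?_⟩
    rw [← h4 hc]
    exact ⟨hcov.isPositive_of_not_isConcentrated hd (fun h => hc (h3.1 h)), hcov.isPositive⟩

theorem eq_of_hasDegree {d e : ℕ} {p : (Fin a → ℕ) × (Fin b → ℕ)} (h : HasDegree d p)
    (h' : HasDegree e p) : d = e := h.1.symm.trans h'.1

theorem not_isConcentrated_of_isReduced {d : ℕ} {p : (Fin a → ℕ) × (Fin b → ℕ)}
    (hd : HasDegree d p) (h0 : 0 < d) (hp : IsReduced p.1 p.2) : ¬ IsConcentrated d p := by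
  rw [IsReduced, hd.1] at hp
  rintro (⟨k, hk⟩ | ⟨l, hl⟩)
  · obtain ⟨l, -, hl⟩ := Finset.exists_ne_zero_of_sum_ne_zero (hd.2.trans_ne h0.ne')
    have h1 := Finset.le_sup (f := p.1) (Finset.mem_univ k)
    have h2 := Finset.le_sup (f := p.2) (Finset.mem_univ l)
    omega
  · obtain ⟨k, -, hk⟩ := Finset.exists_ne_zero_of_sum_ne_zero (hd.1.trans_ne h0.ne')
    have h1 := Finset.le_sup (f := p.1) (Finset.mem_univ k)
    have h2 := Finset.le_sup (f := p.2) (Finset.mem_univ l)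
    omega

/-- An entry equal to the degree can be lowered together with any nonzero entry of the other weight.
This leads down to degree zero, where the only table is 0 and its bitableau is 1. -/
theorem weightTrace_of_isConcentrated {d : ℕ} {q : (Fin a → ℕ) × (Fin b → ℕ)}
    (hd : HasDegree d q) (hc : IsConcentrated d q) : weightTrace q.1 q.2 = 1 := by
  induction d generalizing q with
  | zero =>
    have h1 : q.1 = 0 := funext fun i => Nat.le_zero.1 (le_of_hasDegree_left hd i)
    have h2 : q.2 = 0 := funext fun i => Nat.le_zero.1 (le_of_hasDegree_right hd i)
    rw [h1, h2, weightTrace_zero]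
  | succ d ih =>
    obtain ⟨k, l, h⟩ : ∃ k l, CanLower k l q := by
      rcases hc with ⟨k, hk⟩ | ⟨l, hl⟩
      · obtain ⟨l, -, hl⟩ := Finset.exists_ne_zero_of_sum_ne_zero (hd.2.trans_ne (by omega))
        exact ⟨k, l, by rw [hd.1]; omega, by omega, by omega⟩
      · obtain ⟨k, -, hk⟩ := Finset.exists_ne_zero_of_sum_ne_zero (hd.1.trans_ne (by omega))
        exact ⟨k, l, by rw [hd.1]; omega, by omega, by omega⟩
    have hp := h.covers.hasDegree_iff.1 hd
    rw [weightTrace_eq_of_covers h.covers]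
    exact ih hp ((h.covers.isConcentrated_iff hp).1 hc)

open Relation in
-- `Covers` compares with the sum of the first weight only, so exchanging the weights uses that
-- their degrees agree.
theorem reflTransGen_covers_swap {d : ℕ} {p q : (Fin a → ℕ) × (Fin b → ℕ)}
    (h : ReflTransGen Covers p q) (hq : HasDegree d q) :
    ReflTransGen Covers p.swap q.swap := by
  induction h generalizing d with
  | refl => exact .refl
  | tail _ hcov ih =>
    obtain ⟨e, -, he⟩ := hcov.exists_degree hq
    refine (ih he).tail ?_
    obtain ⟨k, l, h, h1, h2⟩ := hcov
    refine ⟨l, k, ?_, h2, h1⟩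
    rw [Prod.fst_swap, Prod.snd_swap, he.2]
    rw [he.1] at h
    omega

end Reduction

theorem reductionCount_swap {a b : ℕ} (σ : Fin a → ℕ) (π : Fin b → ℕ) (d : ℕ) :
    reductionCount π σ d = reductionCount σ π d := by
  rw [reductionCount, reductionCount,
    ← Set.ncard_image_of_injective _ (Prod.swap_injective (α := Fin a → ℕ) (β := Fin b → ℕ))]
  congr 1
  ext q
  constructor
  · rintro ⟨h1, h2, h⟩
    exact ⟨q.swap, ⟨h2, h1, reflTransGen_covers_swap h ⟨h1, h2⟩⟩, rfl⟩
  · rintro ⟨q, ⟨h1, h2, h⟩, rfl⟩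
    exact ⟨h2, h1, reflTransGen_covers_swap h ⟨h1, h2⟩⟩

/-! ### Weights with nonzero entries -/

/-- The weights of degree `d` with nonzero entries. -/
def posWeights (a d : ℕ) : Finset (Fin a → ℕ) := (weights a d).filter fun τ => ∀ i, 0 < τ i

theorem mem_posWeights {a d : ℕ} {τ : Fin a → ℕ} :
    τ ∈ posWeights a d ↔ ∑ i, τ i = d ∧ ∀ i, 0 < τ i := by
  rw [posWeights, Finset.mem_filter, mem_weights]

theorem posWeights_eq_empty {a d : ℕ} (h : d < a) : posWeights a d = ∅ := by
  refine Finset.eq_empty_of_forall_notMem fun τ hτ => ?_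
  rw [mem_posWeights] at hτ
  have : ∑ _i : Fin a, 1 ≤ ∑ i, τ i := Finset.sum_le_sum fun i _ => hτ.2 i
  simp at this
  omega

theorem posWeights_self (d : ℕ) : posWeights d d = {fun _ => 1} := by
  ext τ
  rw [mem_posWeights, Finset.mem_singleton]
  constructor
  · rintro ⟨h, hpos⟩
    have := (Finset.sum_eq_sum_iff_of_le (s := Finset.univ) (f := fun _ => 1) (g := τ)
      fun i _ => hpos i).1 (by simpa using h.symm)
    exact funext fun i => (this i (Finset.mem_univ i)).symm
  · rintro rfl
    simp

theorem card_posWeights_one {d : ℕ} (hd : 0 < d) : (posWeights 1 d).card = 1 := by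
  rw [Finset.card_eq_one]
  refine ⟨fun _ => d, ?_⟩
  ext τ
  rw [mem_posWeights, Finset.mem_singleton]
  constructor
  · rintro ⟨h, -⟩
    funext i
    rw [Subsingleton.elim i 0]
    simpa using h
  · rintro rfl
    simpa using hd

theorem sum_extend {a m : ℕ} (e : Fin a ↪o Fin m) (τ : Fin a → ℕ) :
    ∑ i, Function.extend e τ 0 i = ∑ i, τ i :=
  (Fintype.sum_of_injective e e.injective _ _ (fun i hi => Function.extend_apply' τ (0 : Fin m → ℕ) i hi)
    fun i => (e.injective.extend_apply τ 0 i).symm).symm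

/-- Sums over weights of functions that do not change on extension by zeros. -/
theorem sum_weights_eq {M : Type*} [AddCommMonoid M] (m d : ℕ) (f : (Fin m → ℕ) → M)
    (g : ∀ a, (Fin a → ℕ) → M)
    (hfg : ∀ a (e : Fin a ↪o Fin m) (τ : Fin a → ℕ), f (Function.extend e τ 0) = g a τ) :
    ∑ σ ∈ weights m d, f σ =
      ∑ a ∈ Finset.range (d + 1), m.choose a • ∑ τ ∈ posWeights a d, g a τ := by
  -- The weights with support S are the weights with nonzero entries of length |S|, placed along the
  -- increasing enumeration of S.
  have h1 : ∀ S ∈ (Finset.univ : Finset (Fin m)).powerset,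
      ∑ σ ∈ weights m d with Finset.univ.filter (fun i => σ i ≠ 0) = S, f σ =
        ∑ τ ∈ posWeights S.card d, g S.card τ := by
    intro S _
    have hrange : ∀ i, i ∈ Set.range (S.orderEmbOfFin rfl) ↔ i ∈ S := fun i => by
      rw [Finset.range_orderEmbOfFin, Finset.mem_coe]
    refine (Finset.sum_nbij (fun τ => Function.extend (S.orderEmbOfFin rfl) τ 0) ?_ ?_ ?_
      fun τ _ => (hfg _ _ τ).symm).symm
    · intro τ hτ
      rw [mem_posWeights] at hτ
      rw [Finset.mem_filter, mem_weights, sum_extend]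
      refine ⟨hτ.1, Finset.ext fun i => ?_⟩
      rw [Finset.mem_filter, ← hrange, and_iff_right (Finset.mem_univ i)]
      constructor
      · intro h
        by_contra hi
        exact h (Function.extend_apply' _ _ _ hi)
      · rintro ⟨j, rfl⟩
        rw [(S.orderEmbOfFin rfl).injective.extend_apply]
        exact (hτ.2 j).ne'
    · intro τ _ τ' _ h
      funext j
      have := congrFun h (S.orderEmbOfFin rfl j)
      simpa only [(S.orderEmbOfFin rfl).injective.extend_apply] using this
    · intro σ hσ
      rw [Finset.mem_coe, Finset.mem_filter, mem_weights] at hσ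
      obtain ⟨hd, hS⟩ := hσ
      have hmem : ∀ i, σ i ≠ 0 ↔ i ∈ S := fun i => by simp [← hS]
      have hext : Function.extend (S.orderEmbOfFin rfl) (σ ∘ S.orderEmbOfFin rfl) 0 = σ := by
        funext i
        by_cases hi : i ∈ Set.range (S.orderEmbOfFin rfl)
        · obtain ⟨j, rfl⟩ := hi
          rw [(S.orderEmbOfFin rfl).injective.extend_apply]
          rfl
        · rw [Function.extend_apply' _ _ _ hi]
          rw [hrange, ← hmem, not_not] at hi
          exact hi.symm
      refine ⟨σ ∘ S.orderEmbOfFin rfl, ?_, hext⟩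
      rw [Finset.mem_coe, mem_posWeights]
      refine ⟨?_, fun j => Nat.pos_of_ne_zero ((hmem _).2 (Finset.orderEmbOfFin_mem S rfl j))⟩
      rw [← hd, ← sum_extend (S.orderEmbOfFin rfl), hext]
  rw [← Finset.sum_fiberwise_of_maps_to (t := (Finset.univ : Finset (Fin m)).powerset)
    (g := fun σ => Finset.univ.filter fun i => σ i ≠ 0) (by simp), Finset.sum_congr rfl h1,
    Finset.sum_powerset_apply_card (fun a => ∑ τ ∈ posWeights a d, g a τ), Finset.card_univ,
    Fintype.card_fin]
  have hm : Finset.range (m + 1) ⊆ Finset.range (m + d + 1) :=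
    Finset.range_subset_range.2 (by omega)
  have hd : Finset.range (d + 1) ⊆ Finset.range (m + d + 1) :=
    Finset.range_subset_range.2 (by omega)
  rw [Finset.sum_subset hm, Finset.sum_subset hd]
  · intro a _ ha
    rw [Finset.mem_range] at ha
    rw [posWeights_eq_empty (by omega), Finset.sum_empty, smul_zero]
  · intro a _ ha
    rw [Finset.mem_range] at ha
    rw [Nat.choose_eq_zero_of_lt (by omega), zero_smul]

/-- The sum of the weight traces over all weights with nonzero entries. -/
noncomputable def posTrace (a b d : ℕ) : ℂ :=
  ∑ σ ∈ posWeights a d, ∑ π ∈ posWeights b d, weightTrace σ π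

theorem trace_degreeMatrix_eq_posTrace (m n d : ℕ) :
    (degreeMatrix m n d).trace = ∑ a ∈ Finset.range (d + 1), ∑ b ∈ Finset.range (d + 1),
      (m.choose a : ℂ) * n.choose b * posTrace a b d := by
  rw [trace_degreeMatrix_eq_sum, sum_weights_eq m d _ (fun a τ =>
    ∑ b ∈ Finset.range (d + 1), n.choose b • ∑ ρ ∈ posWeights b d, weightTrace τ ρ)]
  · refine Finset.sum_congr rfl fun a _ => ?_
    rw [Finset.sum_comm, Finset.smul_sum]
    refine Finset.sum_congr rfl fun b _ => ?_
    rw [posTrace, ← Finset.smul_sum]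
    simp only [nsmul_eq_mul]
    ring
  · exact fun a e τ => sum_weights_eq n d _ _ fun b e' ρ => weightTrace_extend e e' τ ρ

theorem card_weights (m d : ℕ) : (weights m d).card = (m + d - 1).choose d := by
  have h := Finset.card_finsuppAntidiag_nat_eq_choose (s := (Finset.univ : Finset (Fin m))) d
  rw [Finset.card_univ, Fintype.card_fin] at h
  rw [← h]
  refine Finset.card_bij' (fun σ _ => Finsupp.equivFunOnFinite.symm σ) (fun α _ => ⇑α) ?_ ?_ ?_ ?_
  · intro σ hσ
    rw [mem_weights] at hσ
    simpa [Finset.mem_finsuppAntidiag] using hσ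
  · intro α hα
    rw [Finset.mem_finsuppAntidiag] at hα
    exact mem_weights.2 hα.1
  · intro σ _
    rfl
  · intro α _
    ext i
    rfl

theorem sum_choose_mul_card_posWeights (m d : ℕ) :
    ∑ a ∈ Finset.range (d + 1), (m.choose a : ℂ) * (posWeights a d).card =
      ((m + d - 1).choose d : ℕ) := by
  have := sum_weights_eq m d (fun _ => (1 : ℂ)) (fun _ _ => 1) fun _ _ _ => rfl
  simp only [Finset.sum_const, nsmul_eq_mul, mul_one] at this
  rw [← this, card_weights]

/-! ### Decomposition according to the reduced pair -/

/-- An entry equal to the degree leaves zero for all others, which is impossible unless there are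
none. -/
theorem isConcentrated_iff_of_isPositive {a b d : ℕ} {p : (Fin a → ℕ) × (Fin b → ℕ)}
    (hd : HasDegree d p) (hp : IsPositive p) : IsConcentrated d p ↔ a = 1 ∨ b = 1 := by
  have key : ∀ {a : ℕ} {σ : Fin a → ℕ}, ∑ i, σ i = d → (∀ i, 0 < σ i) →
      ((∃ k, σ k = d) ↔ a = 1) := by
    intro a σ hd hp
    constructor
    · rintro ⟨k, hk⟩
      rw [← Fintype.card_fin a, Fintype.card_eq_one_iff]
      refine ⟨k, fun k' => ?_⟩
      by_contra hne
      exact (hp k').ne' (apply_eq_zero_of_sum hd hk hne)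
    · rintro rfl
      exact ⟨0, by simpa using hd⟩
  exact or_congr (key hd.1 hp.1) (key hd.2 hp.2)

open Relation

open scoped Classical in
theorem reductionCount_eq_card {a b d e : ℕ} {p : (Fin a → ℕ) × (Fin b → ℕ)}
    (he : HasDegree e p) (h0 : 0 < e) (hp : IsPositive p) (hr : IsReduced p.1 p.2) :
    reductionCount p.1 p.2 d =
      ((posWeights a d ×ˢ posWeights b d).filter fun q => ReflTransGen Covers p q).card := by
  rw [reductionCount, ← Set.ncard_coe_finset]
  congr 1
  ext q
  simp only [Set.mem_ofPred_eq, Finset.coe_filter, Finset.mem_product, mem_posWeights]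
  constructor
  · rintro ⟨h1, h2, h⟩
    obtain ⟨e', -, he', -, -, hpos⟩ := reduction_spec h ⟨h1, h2⟩
    obtain rfl := eq_of_hasDegree he he'
    have := (hpos (not_isConcentrated_of_isReduced he h0 hr)).2 hp
    exact ⟨⟨⟨h1, this.1⟩, h2, this.2⟩, h⟩
  · rintro ⟨⟨⟨h1, -⟩, h2, -⟩, h⟩
    exact ⟨h1, h2, h⟩

open scoped Classical in
-- If a or b is 1, every pair is concentrated and contributes 1, and no pair of positive degree is
-- reduced. Otherwise each pair has the trace of its unique reduced pair, and the sum is counted by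
-- reduced pairs.
theorem posTrace_eq (a b : ℕ) {d : ℕ} (hd : 0 < d) :
    posTrace a b d =
      (if a = 1 ∨ b = 1 then ((posWeights a d).card : ℂ) * (posWeights b d).card else 0) +
        ∑ e ∈ Finset.Icc 1 d, ∑ σ ∈ posWeights a e, ∑ π ∈ posWeights b e,
          if IsReduced σ π then (reductionCount σ π d : ℂ) * weightTrace σ π else 0 := by
  have hdeg : ∀ {e : ℕ} {p : (Fin a → ℕ) × (Fin b → ℕ)}, p ∈ posWeights a e ×ˢ posWeights b e ↔
      HasDegree e p ∧ IsPositive p := by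
    intro e p
    rw [Finset.mem_product, mem_posWeights, mem_posWeights, HasDegree, IsPositive]
    tauto
  simp only [posTrace, ← Finset.sum_product']
  by_cases hab : a = 1 ∨ b = 1
  · rw [if_pos hab, Finset.sum_eq_zero (s := Finset.Icc 1 d), add_zero, ← Nat.cast_mul,
      ← Finset.card_product]
    · rw [Finset.sum_congr rfl fun q hq => ?_, Finset.sum_const, nsmul_eq_mul, mul_one]
      rw [hdeg] at hq
      exact weightTrace_of_isConcentrated hq.1
        ((isConcentrated_iff_of_isPositive hq.1 hq.2).2 hab)
    · intro e he
      refine Finset.sum_eq_zero fun p hp => if_neg fun hr => ?_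
      rw [hdeg] at hp
      exact not_isConcentrated_of_isReduced hp.1 (Finset.mem_Icc.1 he).1 hr
        ((isConcentrated_iff_of_isPositive hp.1 hp.2).2 hab)
  · rw [if_neg hab, zero_add]
    -- The count is written as a sum of indicators, so that summation over the upper pair q can be
    -- performed last.
    have hterm : ∀ e ∈ Finset.Icc 1 d, ∀ p ∈ posWeights a e ×ˢ posWeights b e,
        (if IsReduced p.1 p.2 then (reductionCount p.1 p.2 d : ℂ) * weightTrace p.1 p.2 else 0) =
          ∑ q ∈ posWeights a d ×ˢ posWeights b d,
            if IsReduced p.1 p.2 ∧ ReflTransGen Covers p q then weightTrace p.1 p.2 else 0 := by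
      intro e he p hp
      rw [hdeg] at hp
      split_ifs with hr
      · rw [reductionCount_eq_card hp.1 (Finset.mem_Icc.1 he).1 hp.2 hr]
        simp only [hr, true_and]
        rw [← Finset.sum_filter, Finset.sum_const, nsmul_eq_mul]
      · simp [hr]
    rw [Finset.sum_congr rfl fun e he => Finset.sum_congr rfl (hterm e he),
      Finset.sum_congr rfl fun e _ => Finset.sum_comm, Finset.sum_comm]
    refine Finset.sum_congr rfl fun q hq => ?_
    rw [hdeg] at hq
    obtain ⟨k, -, -⟩ := Finset.exists_ne_zero_of_sum_ne_zero (hq.1.1.trans_ne hd.ne')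
    obtain ⟨l, -, -⟩ := Finset.exists_ne_zero_of_sum_ne_zero (hq.1.2.trans_ne hd.ne')
    have : Nonempty (Fin a) := ⟨k⟩
    have : Nonempty (Fin b) := ⟨l⟩
    obtain ⟨e, he, p, hpe, hpr, hpq⟩ := exists_reduced hq.1
    obtain ⟨e', -, he', hw, hconc, hpos⟩ := reduction_spec hpq hq.1
    obtain rfl := eq_of_hasDegree hpe he'
    rw [isConcentrated_iff_of_isPositive hq.1 hq.2] at hconc
    have hnc : ¬ IsConcentrated e p := fun h => hab (hconc.2 h)
    -- The zero pair is concentrated, so it cannot occur here.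
    have he0 : 0 < e := by
      refine Nat.pos_of_ne_zero fun h0 => hnc (Or.inl ⟨k, ?_⟩)
      have := le_of_hasDegree_left hpe k
      omega
    rw [Finset.sum_eq_single_of_mem e (Finset.mem_Icc.2 ⟨he0, he⟩),
      Finset.sum_eq_single_of_mem p (hdeg.2 ⟨hpe, (hpos hnc).1 hq.2⟩), if_pos ⟨hpr, hpq⟩, hw]
    · exact fun p' _ hne => if_neg fun h => hne (reduced_unique hq.1 h.1 hpr h.2 hpq)
    · intro e' _ hne
      refine Finset.sum_eq_zero fun p' hp' => if_neg fun h => hne ?_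
      rw [hdeg] at hp'
      obtain rfl := reduced_unique hq.1 h.1 hpr h.2 hpq
      exact eq_of_hasDegree hp'.1 hpe

/-! ### Compositions -/

theorem sum_composition {M : Type*} [AddCommMonoid M] {d N : ℕ} (hN : d ≤ N)
    (G : ∀ a, (Fin a → ℕ) → M) :
    ∑ c : Composition d, G c.length c.blocksFun =
      ∑ a ∈ Finset.range (N + 1), ∑ τ ∈ posWeights a d, G a τ := by
  rw [Finset.sum_sigma']
  refine Finset.sum_nbij (fun c => ⟨c.length, c.blocksFun⟩) ?_ ?_ ?_ fun _ _ => rfl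
  · intro c _
    rw [Finset.mem_sigma, Finset.mem_range, mem_posWeights]
    exact ⟨Nat.lt_succ_of_le (c.length_le.trans hN), c.sum_blocksFun,
      fun i => c.blocks_pos (c.blocksFun_mem_blocks i)⟩
  · intro c _ c' _ h
    have := congrArg (fun s : Σ a, Fin a → ℕ => List.ofFn s.2) h
    simp only [Composition.ofFn_blocksFun] at this
    exact Composition.ext this
  · rintro ⟨a, τ⟩ h
    rw [Finset.mem_coe, Finset.mem_sigma, mem_posWeights] at h
    refine ⟨⟨List.ofFn τ, fun {i} hi => ?_, by rw [List.sum_ofFn]; exact h.2.1⟩,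
      Finset.mem_coe.2 (Finset.mem_univ _), ?_⟩
    · obtain ⟨j, rfl⟩ := List.mem_ofFn.1 hi
      exact h.2.2 j
    · refine List.equivSigmaTuple.symm.injective ?_
      exact Composition.ofFn_blocksFun _

/-- Normalization selects exactly one of (σ,π) and (π,σ), because the lexicographic order on blocks
is total and asymmetric. -/
theorem isNormalized_swap_iff {d : ℕ} {σ π : Composition d} (h : σ ≠ π) :
    IsNormalized π σ ↔ ¬ IsNormalized σ π := by
  have hb : σ.blocks ≠ π.blocks := fun h' => h (Composition.ext h')
  rcases lt_trichotomy σ.length π.length with hl | hl | hl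
  · simp [IsNormalized, hl.ne, hl.le, hl.not_ge]
  · simp only [IsNormalized, hl, le_refl, true_and, true_implies, h, h.symm, false_or]
    exact ⟨fun h1 h2 => asymm h1 h2, fun h1 => by
      by_contra h2
      exact hb (Std.Trichotomous.trichotomous _ _ h1 h2)⟩
  · simp [IsNormalized, hl.ne', hl.le, hl.not_ge, hl.ne]

theorem isNormalized_self {d : ℕ} (σ : Composition d) : IsNormalized σ σ :=
  ⟨le_rfl, fun _ => Or.inl rfl⟩

theorem isReduced_swap_iff {d : ℕ} (σ π : Composition d) :
    IsReduced π.blocksFun σ.blocksFun ↔ IsReduced σ.blocksFun π.blocksFun := by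
  rw [IsReduced, IsReduced, σ.sum_blocksFun, π.sum_blocksFun, add_comm]

open scoped Classical in
-- Each pair that is not normalized is folded onto its swap, which has the same trace and reduction
-- count but exchanged binomials; diagonal pairs occur once. This explains the two cases of
-- `multiplicity`.
theorem sum_reduced_eq (m n d e : ℕ) :
    ∑ σ : Composition e, ∑ π : Composition e,
        (m.choose σ.length : ℂ) * n.choose π.length *
          (if IsReduced σ.blocksFun π.blocksFun then
            (reductionCount σ.blocksFun π.blocksFun d : ℂ) *
              weightTrace σ.blocksFun π.blocksFun else 0) =
      ∑ p ∈ reducedPairs e, (multiplicity p.1 p.2 m n d : ℂ) *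
        (weightMatrix p.1.blocksFun p.2.blocksFun).trace := by
  let G : Composition e × Composition e → ℂ := fun p =>
    (m.choose p.1.length : ℂ) * n.choose p.2.length *
      ((reductionCount p.1.blocksFun p.2.blocksFun d : ℂ) *
        weightTrace p.1.blocksFun p.2.blocksFun)
  let R : Finset (Composition e × Composition e) :=
    Finset.univ.filter fun p => IsReduced p.1.blocksFun p.2.blocksFun
  have hl : ∑ σ : Composition e, ∑ π : Composition e,
        (m.choose σ.length : ℂ) * n.choose π.length *
          (if IsReduced σ.blocksFun π.blocksFun then
            (reductionCount σ.blocksFun π.blocksFun d : ℂ) *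
              weightTrace σ.blocksFun π.blocksFun else 0) = ∑ p ∈ R, G p := by
    rw [Finset.sum_filter, Fintype.sum_prod_type]
    refine Finset.sum_congr rfl fun σ _ => Finset.sum_congr rfl fun π _ => ?_
    split_ifs
    · rfl
    · rw [mul_zero]
  have hR : reducedPairs e = R.filter fun p => IsNormalized p.1 p.2 := by
    rw [reducedPairs, Finset.filter_filter]
  have hswap : ∑ p ∈ R with ¬ IsNormalized p.1 p.2, G p =
      ∑ p ∈ R with IsNormalized p.1 p.2, if p.1 = p.2 then 0 else G p.swap := by
    have : ∑ p ∈ R with IsNormalized p.1 p.2, (if p.1 = p.2 then 0 else G p.swap) =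
        ∑ p ∈ (R.filter fun p => IsNormalized p.1 p.2).filter fun p => ¬ p.1 = p.2, G p.swap := by
      rw [Finset.sum_filter (fun p : Composition e × Composition e => ¬ p.1 = p.2)]
      exact Finset.sum_congr rfl fun p _ => by split_ifs <;> rfl
    rw [this]
    refine Finset.sum_nbij' Prod.swap Prod.swap ?_ ?_ (fun _ _ => rfl) (fun _ _ => rfl)
      fun _ _ => rfl
    · rintro ⟨σ, π⟩ h
      simp only [R, Finset.mem_filter, Finset.mem_univ, true_and, Prod.fst_swap,
        Prod.snd_swap] at h ⊢
      have hne : σ ≠ π := fun h' => h.2 (h' ▸ isNormalized_self σ)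
      exact ⟨⟨(isReduced_swap_iff σ π).2 h.1, (isNormalized_swap_iff hne).2 h.2⟩, hne.symm⟩
    · rintro ⟨σ, π⟩ h
      simp only [R, Finset.mem_filter, Finset.mem_univ, true_and, Prod.fst_swap,
        Prod.snd_swap] at h ⊢
      exact ⟨(isReduced_swap_iff σ π).2 h.1.1, (isNormalized_swap_iff (Ne.symm h.2)).1 h.1.2⟩
  rw [hl, ← Finset.sum_filter_add_sum_filter_not R fun p => IsNormalized p.1 p.2, hswap,
    ← Finset.sum_add_distrib, hR]
  refine Finset.sum_congr rfl fun p _ => ?_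
  rw [multiplicity, trace_weightMatrix]
  split_ifs with h
  · simp only [G]
    push_cast
    ring
  · simp only [G, Prod.fst_swap, Prod.snd_swap, weightTrace_swap p.1.blocksFun,
      reductionCount_swap p.1.blocksFun]
    push_cast
    ring

/-- Inclusion and exclusion for the conditions a = 1 and b = 1. There is one weight of length 1 for
each choice of a row, and m or n choices of its position. -/
theorem multiplicityZero_eq (m n : ℕ) {d : ℕ} (hd : 0 < d) :
    ∑ a ∈ Finset.range (d + 1), ∑ b ∈ Finset.range (d + 1),
      (m.choose a : ℂ) * n.choose b *
        (if a = 1 ∨ b = 1 then ((posWeights a d).card : ℂ) * (posWeights b d).card else 0) =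
      (multiplicityZero m n d : ℂ) := by
  have hterm : ∀ a b : ℕ, (m.choose a : ℂ) * n.choose b *
      (if a = 1 ∨ b = 1 then ((posWeights a d).card : ℂ) * (posWeights b d).card else 0) =
      (if a = 1 then (m.choose a : ℂ) * (posWeights a d).card else 0) *
          ((n.choose b : ℂ) * (posWeights b d).card) +
        (m.choose a : ℂ) * (posWeights a d).card *
          (if b = 1 then (n.choose b : ℂ) * (posWeights b d).card else 0) -
        (if a = 1 then (m.choose a : ℂ) * (posWeights a d).card else 0) *
          (if b = 1 then (n.choose b : ℂ) * (posWeights b d).card else 0) := by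
    intro a b
    by_cases ha : a = 1 <;> by_cases hb : b = 1 <;> simp [ha, hb] <;> ring
  simp only [hterm, Finset.sum_add_distrib, Finset.sum_sub_distrib, ← Finset.sum_mul_sum]
  simp only [sum_choose_mul_card_posWeights, Finset.sum_ite_eq', Finset.mem_range,
    show 1 < d + 1 by omega, if_true, card_posWeights_one hd, Nat.choose_one_right]
  rw [multiplicityZero, add_comm d n, add_comm d m]
  push_cast
  ring

theorem trace_degreeMatrix_eq (m n : ℕ) {d : ℕ} (hd : 0 < d) :
    (degreeMatrix m n d).trace =
      (multiplicityZero m n d : ℂ) +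
        ∑ e ∈ Finset.Icc 1 d, ∑ p ∈ reducedPairs e,
          (multiplicity p.1 p.2 m n d : ℂ) *
            (weightMatrix p.1.blocksFun p.2.blocksFun).trace := by
  classical
  simp only [trace_degreeMatrix_eq_posTrace, posTrace_eq _ _ hd, mul_add,
    Finset.sum_add_distrib, multiplicityZero_eq m n hd]
  congr 1
  simp only [Finset.mul_sum (Finset.Icc 1 d)]
  rw [Finset.sum_congr rfl fun a _ => Finset.sum_comm, Finset.sum_comm]
  refine Finset.sum_congr rfl fun e he => ?_
  have hed := (Finset.mem_Icc.1 he).2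
  rw [← sum_reduced_eq, sum_composition hed fun a τ => ∑ π : Composition e,
    (m.choose a : ℂ) * n.choose π.length * (if IsReduced τ π.blocksFun then
      (reductionCount τ π.blocksFun d : ℂ) * weightTrace τ π.blocksFun else 0)]
  refine Finset.sum_congr rfl fun a _ => ?_
  rw [Finset.sum_congr rfl fun τ _ => sum_composition hed fun b ρ =>
    (m.choose a : ℂ) * n.choose b * (if IsReduced τ ρ then
      (reductionCount τ ρ d : ℂ) * weightTrace τ ρ else 0), Finset.sum_comm]
  simp only [Finset.mul_sum]

/-! ### Polynomiality -/

/-- The binomial coefficient `x ↦ (x choose a)` as a polynomial. -/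
noncomputable def choosePoly (a : ℕ) : Polynomial ℂ :=
  Polynomial.C ((a.factorial : ℂ)⁻¹) * descPochhammer ℂ a

theorem eval_choosePoly (a m : ℕ) : (choosePoly a).eval (m : ℂ) = m.choose a := by
  rw [choosePoly, Polynomial.eval_mul, Polynomial.eval_C, Nat.cast_choose_eq_descPochhammer_div,
    div_eq_inv_mul]

theorem natDegree_choosePoly_le (a : ℕ) : (choosePoly a).natDegree ≤ a :=
  (Polynomial.natDegree_C_mul_le _ _).trans (descPochhammer_natDegree ℂ a).le

theorem coeff_choosePoly {a d : ℕ} (h : a ≤ d) :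
    (choosePoly a).coeff d = if a = d then (d.factorial : ℂ)⁻¹ else 0 := by
  split_ifs with had
  · subst had
    have := (monic_descPochhammer ℂ a).coeff_natDegree
    rw [descPochhammer_natDegree] at this
    rw [choosePoly, Polynomial.coeff_C_mul, this, mul_one]
  · exact Polynomial.coeff_eq_zero_of_natDegree_lt
      ((natDegree_choosePoly_le a).trans_lt (lt_of_le_of_ne h had))

open MvPolynomial in
theorem aeval_mul_aeval_eq_sum {p q : Polynomial ℂ} {d : ℕ} (hp : p.natDegree ≤ d)
    (hq : q.natDegree ≤ d) :
    Polynomial.aeval (X 0 : MvPolynomial (Fin 2) ℂ) p * Polynomial.aeval (X 1) q =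
      ∑ i ∈ Finset.range (d + 1), ∑ j ∈ Finset.range (d + 1),
        C (p.coeff i * q.coeff j) * (X 0 ^ i * X 1 ^ j) := by
  rw [Polynomial.aeval_eq_sum_range' (Nat.lt_succ_of_le hp),
    Polynomial.aeval_eq_sum_range' (Nat.lt_succ_of_le hq), Finset.sum_mul_sum]
  refine Finset.sum_congr rfl fun i _ => Finset.sum_congr rfl fun j _ => ?_
  rw [smul_eq_C_mul, smul_eq_C_mul, C_mul]
  ring

open MvPolynomial in
theorem isHomogeneous_C_mul_X_pow (c : ℂ) (i j : ℕ) :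
    (C c * (X 0 ^ i * X 1 ^ j) : MvPolynomial (Fin 2) ℂ).IsHomogeneous (i + j) := by
  have := (isHomogeneous_C (Fin 2) c).mul ((isHomogeneous_X_pow (R := ℂ) (0 : Fin 2) i).mul
    (isHomogeneous_X_pow (R := ℂ) (1 : Fin 2) j))
  rwa [zero_add] at this

open MvPolynomial in
theorem homogeneousComponent_aeval_mul_aeval {p q : Polynomial ℂ} {d : ℕ} (hp : p.natDegree ≤ d)
    (hq : q.natDegree ≤ d) :
    homogeneousComponent (2 * d)
        (Polynomial.aeval (X 0 : MvPolynomial (Fin 2) ℂ) p * Polynomial.aeval (X 1) q) =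
      C (p.coeff d * q.coeff d) * (X 0 ^ d * X 1 ^ d) := by
  rw [aeval_mul_aeval_eq_sum hp hq]
  simp only [map_sum, homogeneousComponent_of_mem (isHomogeneous_C_mul_X_pow _ _ _)]
  rw [Finset.sum_eq_single_of_mem d (by simp), Finset.sum_eq_single_of_mem d (by simp),
    if_pos (by ring)]
  · intro j hj hne
    rw [Finset.mem_range] at hj
    exact if_neg (by omega)
  · intro i hi hne
    refine Finset.sum_eq_zero fun j hj => if_neg ?_
    rw [Finset.mem_range] at hi hj
    omega

open MvPolynomial in
theorem totalDegree_aeval_mul_aeval_le {p q : Polynomial ℂ} {d : ℕ} (hp : p.natDegree ≤ d)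
    (hq : q.natDegree ≤ d) :
    (Polynomial.aeval (X 0 : MvPolynomial (Fin 2) ℂ) p * Polynomial.aeval (X 1) q).totalDegree ≤
      2 * d := by
  rw [aeval_mul_aeval_eq_sum hp hq]
  refine totalDegree_finsetSum_le fun i hi => totalDegree_finsetSum_le fun j hj => ?_
  rw [Finset.mem_range] at hi hj
  exact (isHomogeneous_C_mul_X_pow _ i j).totalDegree_le.trans (by omega)

/-- The trace of RSK in degree `d` as a polynomial in `m` and `n`. -/
noncomputable def tracePoly (d : ℕ) : MvPolynomial (Fin 2) ℂ :=
  ∑ a ∈ Finset.range (d + 1), ∑ b ∈ Finset.range (d + 1), posTrace a b d •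
    (Polynomial.aeval (MvPolynomial.X 0) (choosePoly a) *
      Polynomial.aeval (MvPolynomial.X 1) (choosePoly b))

theorem eval_tracePoly (m n d : ℕ) :
    MvPolynomial.eval ![(m : ℂ), (n : ℂ)] (tracePoly d) = (degreeMatrix m n d).trace := by
  have h : ∀ (i : Fin 2) (p : Polynomial ℂ) (v : Fin 2 → ℂ), MvPolynomial.eval v
      (Polynomial.aeval (MvPolynomial.X i) p) = p.eval (v i) := fun i p v => by
    rw [← MvPolynomial.coe_aeval_eq_eval, RingHom.coe_coe, ← Polynomial.aeval_algHom_apply,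
      MvPolynomial.aeval_X, Polynomial.coe_aeval_eq_eval]
  rw [trace_degreeMatrix_eq_posTrace, tracePoly]
  simp only [map_sum, MvPolynomial.smul_eval, map_mul, h, Matrix.cons_val_zero,
    Matrix.cons_val_one, eval_choosePoly]
  exact Finset.sum_congr rfl fun a _ => Finset.sum_congr rfl fun b _ => by ring

theorem totalDegree_tracePoly_le (d : ℕ) : (tracePoly d).totalDegree ≤ 2 * d := by
  refine MvPolynomial.totalDegree_finsetSum_le fun a ha =>
    MvPolynomial.totalDegree_finsetSum_le fun b hb => ?_
  rw [Finset.mem_range] at ha hb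
  exact (MvPolynomial.totalDegree_smul_le _ _).trans (totalDegree_aeval_mul_aeval_le
    ((natDegree_choosePoly_le a).trans (by omega)) ((natDegree_choosePoly_le b).trans (by omega)))

/-- The polynomial of x choose a has degree a and leading coefficient 1/a!, so only a = b = d
contributes. -/
theorem homogeneousComponent_tracePoly (d : ℕ) :
    MvPolynomial.homogeneousComponent (2 * d) (tracePoly d) =
      MvPolynomial.C (posTrace d d d / (d.factorial : ℂ) ^ 2) *
        (MvPolynomial.X 0 ^ d * MvPolynomial.X 1 ^ d) := by
  have h : ∀ a ∈ Finset.range (d + 1), ∀ b ∈ Finset.range (d + 1),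
      MvPolynomial.homogeneousComponent (2 * d) (posTrace a b d •
        (Polynomial.aeval (MvPolynomial.X 0 : MvPolynomial (Fin 2) ℂ) (choosePoly a) *
          Polynomial.aeval (MvPolynomial.X 1) (choosePoly b))) =
      if b = d then (if a = d then MvPolynomial.C (posTrace d d d / (d.factorial : ℂ) ^ 2) *
        (MvPolynomial.X 0 ^ d * MvPolynomial.X 1 ^ d) else 0) else 0 := by
    intro a ha b hb
    rw [Finset.mem_range] at ha hb
    rw [map_smul, homogeneousComponent_aeval_mul_aeval
      ((natDegree_choosePoly_le a).trans (by omega))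
      ((natDegree_choosePoly_le b).trans (by omega)),
      coeff_choosePoly (by omega), coeff_choosePoly (by omega)]
    by_cases had : a = d <;> by_cases hbd : b = d
    · subst had
      subst hbd
      simp only [if_true]
      rw [MvPolynomial.smul_eq_C_mul, ← mul_assoc, ← MvPolynomial.C_mul]
      congr 2
      rw [div_eq_mul_inv, sq, mul_inv]
    all_goals simp [had, hbd]
  rw [tracePoly]
  simp only [map_sum]
  rw [Finset.sum_congr rfl fun a ha => Finset.sum_congr rfl (h a ha)]
  simp

theorem posTrace_self (d : ℕ) :
    posTrace d d d = (weightMatrix (fun _ : Fin d => 1) (fun _ : Fin d => 1)).trace := by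
  rw [posTrace, posWeights_self, Finset.sum_singleton, Finset.sum_singleton, trace_weightMatrix]

/-- Nonemptiness gives a ≤ d and excludes a = 0 < d, where the bound would fail at m = 0. -/
theorem choose_le_pow_of_posWeights_nonempty {a d : ℕ} (h : (posWeights a d).Nonempty) (m : ℕ) :
    m.choose a ≤ m ^ d := by
  obtain ⟨τ, hτ⟩ := h
  have had : a ≤ d := by
    by_contra had
    rw [posWeights_eq_empty (not_le.1 had)] at hτ
    simp at hτ
  rw [mem_posWeights] at hτ
  rcases Nat.eq_zero_or_pos m with rfl | hm
  · rcases Nat.eq_zero_or_pos a with rfl | ha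
    · have : d = 0 := by simpa using hτ.1.symm
      simp [this]
    · rw [Nat.choose_eq_zero_of_lt ha]
      exact Nat.zero_le _
  · exact (Nat.choose_le_pow m a).trans (Nat.pow_le_pow_right hm had)

theorem norm_trace_degreeMatrix_le (m n d : ℕ) :
    ‖(degreeMatrix m n d).trace‖ ≤
      (∑ a ∈ Finset.range (d + 1), ∑ b ∈ Finset.range (d + 1), ‖posTrace a b d‖) *
        ((m : ℝ) ^ d * (n : ℝ) ^ d) := by
  rw [trace_degreeMatrix_eq_posTrace, Finset.sum_mul]
  refine (norm_sum_le _ _).trans (Finset.sum_le_sum fun a _ => ?_)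
  rw [Finset.sum_mul]
  refine (norm_sum_le _ _).trans (Finset.sum_le_sum fun b _ => ?_)
  rw [norm_mul, norm_mul, Complex.norm_natCast, Complex.norm_natCast, mul_comm]
  rcases (posWeights a d).eq_empty_or_nonempty with ha | ha
  · simp [posTrace, ha]
  rcases (posWeights b d).eq_empty_or_nonempty with hb | hb
  · simp [posTrace, hb]
  refine mul_le_mul_of_nonneg_left ?_ (norm_nonneg _)
  exact mod_cast Nat.mul_le_mul (choose_le_pow_of_posWeights_nonempty ha m)
    (choose_le_pow_of_posWeights_nonempty hb n)

end RSKTrace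

theorem theorem7p1 (d : ℕ) :
    (0 < d → ∀ m n : ℕ,
      (RSKTrace.degreeMatrix m n d).trace =
        (RSKTrace.multiplicityZero m n d : ℂ) +
          ∑ e ∈ Finset.Icc 1 d, ∑ p ∈ RSKTrace.reducedPairs e,
            (RSKTrace.multiplicity p.1 p.2 m n d : ℂ) *
              (RSKTrace.weightMatrix p.1.blocksFun p.2.blocksFun).trace) ∧
    ∃ F : MvPolynomial (Fin 2) ℂ,
      (∀ m n : ℕ,
        (RSKTrace.degreeMatrix m n d).trace = MvPolynomial.eval ![(m : ℂ), (n : ℂ)] F) ∧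
      (∃ K : ℝ, ∀ m n : ℕ,
        ‖(RSKTrace.degreeMatrix m n d).trace‖ ≤ K * ((m : ℝ) ^ d * (n : ℝ) ^ d)) ∧
      ((RSKTrace.weightMatrix (fun _ : Fin d => 1) (fun _ : Fin d => 1)).trace ≠ 0 →
        F.totalDegree = 2 * d ∧
        MvPolynomial.homogeneousComponent (2 * d) F =
          MvPolynomial.C
              ((RSKTrace.weightMatrix (fun _ : Fin d => 1) (fun _ : Fin d => 1)).trace /
                ((Nat.factorial d : ℂ) ^ 2)) *
            (MvPolynomial.X 0 ^ d * MvPolynomial.X 1 ^ d)) := by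
  refine ⟨fun hd m n => RSKTrace.trace_degreeMatrix_eq m n hd, RSKTrace.tracePoly d,
    fun m n => (RSKTrace.eval_tracePoly m n d).symm,
    ⟨_, fun m n => RSKTrace.norm_trace_degreeMatrix_le m n d⟩, fun h => ?_⟩
  have hcomp := RSKTrace.homogeneousComponent_tracePoly d
  rw [RSKTrace.posTrace_self] at hcomp
  refine ⟨(RSKTrace.totalDegree_tracePoly_le d).antisymm ?_, hcomp⟩
  -- Below total degree 2d the top component would vanish, but its coefficient is nonzero.
  by_contra hlt
  rw [MvPolynomial.homogeneousComponent_eq_zero _ _ (not_le.1 hlt)] at hcomp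
  have hd : (d.factorial : ℂ) ≠ 0 := Nat.cast_ne_zero.2 d.factorial_ne_zero
  refine mul_ne_zero ?_ (mul_ne_zero ?_ ?_) hcomp.symm
  · exact MvPolynomial.C_ne_zero.2 (div_ne_zero h (pow_ne_zero 2 hd))
  · exact pow_ne_zero d (MvPolynomial.X_ne_zero 0)
  · exact pow_ne_zero d (MvPolynomial.X_ne_zero 1)
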